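/- Model of computation. A program is a finite program of a real RAM: it has natural number variables and finitely many named unbounded two-dimensional arrays of naturals and of reals (indexed by naturals), sequencing, conditionals and while loops. Elementary operations are: integer constants; reading or writing a variable or an array entry; addition and truncated subtraction of naturals; exact $+,-,\times,/$ and $\sqrt{\cdot}$ of reals (with the value $0$ when undefined); comparisons of naturals and of reals, and Boolean combinations. Each costs one step. In addition the program may call a subroutine that returns, for a symmetric $k\times k$ real matrix $M$, an eigenvalue decomposition $M=U\,\mathrm{diag}(w)\,U^{\mathsf T}$ with $U$ orthogonal and $w$ nonincreasing; such a call costs $k^3+1$ steps, and the program has to be correct whichever decomposition is returned. The program does not depend on the input. Problem. Given integers $1\le d\le s<n$ and a positive semidefinite matrix $K\in\mathbb R^{n\times n}$, sparse PCA is $$\max\{\operatorname{trace}(X^{\mathsf T}KX)\;:\;X\in\mathbb R^{n\times d},\ X^{\mathsf T}X=I_d,\ |\mathrm{supp}(X)|\le s\},$$ where $\mathrm{supp}(X)$ is the set of indices of the nonzero rows of $X$. An optimal support is a set $S\subseteq\{1,\dots,n\}$ with $|S|=s$ and $\mathrm{supp}(X^*)\subseteq S$ for some optimal solution $X^*$.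 Theorem. There are a program and a constant $C$ such that, for all such $n,d,s,K$, with $r$ the rank of $K$, the program halts on input $(n,d,s,K)$ and returns an optimal solution $X$ of sparse PCA, together with a list of at most $$C\,n^{\min\{d,r\}(r^2+r)}$$ candidate supports, i.e. subsets of $\{1,\dots,n\}$ of cardinality $s$, at least one of which is an optimal support. If $K\ne 0$, it halts after at most $$C\,n^{\min\{d,r\}(r^2+r)}\bigl(\min\{d,r\}\,n\,r^2+n\log n\bigr)$$ steps. The constant $C$ is absolute: it does not depend on $n,d,s,r,K$. -/

import Mathlib

open Matrix

namespace SPCA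

/-! ### The optimization problem -/

/-- The set of indices of the nonzero rows of `X`. -/
def rowSupport {n d : ℕ} (X : Matrix (Fin n) (Fin d) ℝ) : Set (Fin n) :=
  {i | ∃ j, X i j ≠ 0}

/-- `X` has orthonormal columns and at most `s` nonzero rows. -/
def IsFeasible {n d : ℕ} (s : ℕ) (X : Matrix (Fin n) (Fin d) ℝ) : Prop :=
  Xᵀ * X = 1 ∧ (rowSupport X).ncard ≤ s

/-- `X` maximizes `trace (Xᵀ K X)` over the feasible matrices. -/
def IsOptimal {n d : ℕ} (K : Matrix (Fin n) (Fin n) ℝ) (s : ℕ)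
    (X : Matrix (Fin n) (Fin d) ℝ) : Prop :=
  IsFeasible s X ∧
    ∀ Z : Matrix (Fin n) (Fin d) ℝ, IsFeasible s Z → (Zᵀ * K * Z).trace ≤ (Xᵀ * K * X).trace

/-- `S` has exactly `s` elements and contains the row support of some optimal solution. -/
def IsOptimalSupport {n : ℕ} (K : Matrix (Fin n) (Fin n) ℝ) (d s : ℕ) (S : Set (Fin n)) : Prop :=
  S.ncard = s ∧ ∃ X : Matrix (Fin n) (Fin d) ℝ, IsOptimal K s X ∧ rowSupport X ⊆ S

/-! ### The machine model

A uniform real RAM, programmed in a structured language.  A program is a finite object that does not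
depend on the input, and every operation is charged for. -/

/-- The memory: natural number variables, and named two-dimensional arrays of naturals
and of reals. -/
structure State where
  /-- the variables -/
  var : ℕ → ℕ
  /-- `nat a i j` is the entry `(i, j)` of the array of naturals with name `a` -/
  nat : ℕ → ℕ → ℕ → ℕ
  /-- `real a i j` is the entry `(i, j)` of the array of reals with name `a` -/
  real : ℕ → ℕ → ℕ → ℝ

/-- Expressions for naturals (indices, counters): neither products nor quotients. -/
inductive NExp where
  | const (c : ℕ)
  | var (v : ℕ)
  | get (a : ℕ) (i j : NExp)
  | add (e f : NExp)
  | sub (e f : NExp)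

/-- Expressions for reals.  The only constants are integers. -/
inductive RExp where
  | const (c : ℤ)
  | get (a : ℕ) (i j : NExp)
  | add (e f : RExp)
  | sub (e f : RExp)
  | mul (e f : RExp)
  | div (e f : RExp)
  | sqrt (e : RExp)

/-- Tests. -/
inductive Test where
  | nle (e f : NExp)
  | rle (e f : RExp)
  | not (b : Test)
  | and (b c : Test)

/-- Programs. -/
inductive Prog where
  | skip
  /-- assign to a variable -/
  | setVar (v : ℕ) (e : NExp)
  /-- assign to the entry `(i, j)` of an array of naturals -/
  | setNat (a : ℕ) (i j : NExp) (e : NExp)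
  /-- assign to the entry `(i, j)` of an array of reals -/
  | setReal (a : ℕ) (i j : NExp) (e : RExp)
  /-- eigenvalue decomposition of the leading `k × k` block of the real array `src`; the eigenvalues
  go to the first `k` entries of column `0` of `vals`, the eigenvectors, as columns, to the leading
  `k × k` block of `vecs` -/
  | eig (k : NExp) (src vals vecs : ℕ)
  | seq (p q : Prog)
  | ite (b : Test) (p q : Prog)
  | loop (b : Test) (p : Prog)

/-- Value of an expression for naturals (truncated subtraction). -/
def NExp.eval (σ : State) : NExp → ℕ
  | const c => c
  | var v => σ.var v
  | get a i j => σ.nat a (i.eval σ) (j.eval σ)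
  | add e f => e.eval σ + f.eval σ
  | sub e f => e.eval σ - f.eval σ

/-- One step per node of the expression. -/
def NExp.cost : NExp → ℕ
  | const _ => 1
  | var _ => 1
  | get _ i j => 1 + i.cost + j.cost
  | add e f => 1 + e.cost + f.cost
  | sub e f => 1 + e.cost + f.cost

/-- Value of an expression for reals, in exact arithmetic (division by zero, like the square root of
a negative number, gives `0`). -/
noncomputable def RExp.eval (σ : State) : RExp → ℝ
  | const c => (c : ℝ)
  | get a i j => σ.real a (i.eval σ) (j.eval σ)
  | add e f => e.eval σ + f.eval σ
  | sub e f => e.eval σ - f.eval σ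
  | mul e f => e.eval σ * f.eval σ
  | div e f => e.eval σ / f.eval σ
  | sqrt e => Real.sqrt (e.eval σ)

/-- One step per node of the expression. -/
def RExp.cost : RExp → ℕ
  | const _ => 1
  | get _ i j => 1 + i.cost + j.cost
  | add e f => 1 + e.cost + f.cost
  | sub e f => 1 + e.cost + f.cost
  | mul e f => 1 + e.cost + f.cost
  | div e f => 1 + e.cost + f.cost
  | sqrt e => 1 + e.cost

/-- Truth of a test. -/
def Test.holds (σ : State) : Test → Prop
  | nle e f => e.eval σ ≤ f.eval σ
  | rle e f => e.eval σ ≤ f.eval σ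
  | not b => ¬ b.holds σ
  | and b c => b.holds σ ∧ c.holds σ

/-- One step per node of the test. -/
def Test.cost : Test → ℕ
  | nle e f => 1 + e.cost + f.cost
  | rle e f => 1 + e.cost + f.cost
  | not b => 1 + b.cost
  | and b c => 1 + b.cost + c.cost

/-- A subroutine that returns, for every real symmetric matrix `M` of any size, some eigenvalue
decomposition `M U = U diag(w)` with `U` orthogonal and `w` nonincreasing.  Nothing is assumed on
which decomposition is returned, nor on its behaviour on other matrices. -/
structure EigenSolver where
  vals : ∀ {k : ℕ}, Matrix (Fin k) (Fin k) ℝ → Fin k → ℝ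
  vecs : ∀ {k : ℕ}, Matrix (Fin k) (Fin k) ℝ → Matrix (Fin k) (Fin k) ℝ
  antitone_vals : ∀ {k : ℕ} (M : Matrix (Fin k) (Fin k) ℝ), M.IsSymm → Antitone (vals M)
  orthonormal_vecs : ∀ {k : ℕ} (M : Matrix (Fin k) (Fin k) ℝ), M.IsSymm → (vecs M)ᵀ * vecs M = 1
  decomposition : ∀ {k : ℕ} (M : Matrix (Fin k) (Fin k) ℝ), M.IsSymm →
    M * vecs M = vecs M * diagonal (vals M)

/-- Every real symmetric matrix has an eigenvalue decomposition, so such subroutines exist. -/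
theorem EigenSolver.nonempty : Nonempty EigenSolver := by
  have key : ∀ {k : ℕ} (M : Matrix (Fin k) (Fin k) ℝ), ∃ (w : Fin k → ℝ)
      (U : Matrix (Fin k) (Fin k) ℝ), M.IsSymm →
        Antitone w ∧ Uᵀ * U = 1 ∧ M * U = U * diagonal w := by
    intro k M
    by_cases hM : M.IsSymm
    swap
    · exact ⟨0, 0, fun h => absurd h hM⟩
    have hH : M.IsHermitian := by rw [Matrix.IsHermitian, Matrix.conjTranspose_eq_transpose_of_trivial]; exact hM
    let p := Tuple.sort (fun i => - hH.eigenvalues i)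
    let V : Matrix (Fin k) (Fin k) ℝ := hH.eigenvectorUnitary
    have hV : Vᵀ * V = 1 := by
      have := Unitary.coe_star_mul_self hH.eigenvectorUnitary
      simpa [Matrix.star_eq_conjTranspose] using this
    have hd : M * V = V * diagonal hH.eigenvalues := by
      ext i j
      have := congrFun (hH.mulVec_eigenvectorBasis j) i
      simpa [V, Matrix.mul_apply, Matrix.mulVec, dotProduct, diagonal, mul_comm] using this
    refine ⟨hH.eigenvalues ∘ p, V.submatrix id p, fun _ => ⟨?_, ?_, ?_⟩⟩
    · intro i j hij
      have := Tuple.monotone_sort (fun i => - hH.eigenvalues i) hij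
      simpa [p] using this
    · have : (V.submatrix id p)ᵀ * V.submatrix id p = (Vᵀ * V).submatrix p p := by
        ext i j; simp [Matrix.mul_apply]
      rw [this, hV]; ext i j; simp [Matrix.one_apply]
    · ext i j
      have := congrFun (congrFun hd i) (p j)
      simpa [Matrix.mul_apply, diagonal] using this
  choose w U h using @key
  exact ⟨⟨fun M => w M, fun M => U M, fun M hM => (h M hM).1, fun M hM => (h M hM).2.1,
    fun M hM => (h M hM).2.2⟩⟩

/-- Overwrite one entry of one array. -/
def put {α : Type} (A : ℕ → ℕ → ℕ → α) (a i j : ℕ) (x : α) : ℕ → ℕ → ℕ → α :=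
  fun a' i' j' => if a' = a ∧ i' = i ∧ j' = j then x else A a' i' j'

/-- The leading `m × k` block of the real array `a`. -/
def State.block (σ : State) (a m k : ℕ) : Matrix (Fin m) (Fin k) ℝ :=
  Matrix.of fun i j => σ.real a i j

/-- The effect of the instruction `eig`. -/
def State.eig (E : EigenSolver) (σ : State) (k src vals vecs : ℕ) : State :=
  { σ with
    real := fun a i j =>
      if h : a = vecs ∧ i < k ∧ j < k then
        E.vecs (σ.block src k k) ⟨i, h.2.1⟩ ⟨j, h.2.2⟩
      else if h : a = vals ∧ i < k ∧ j = 0 then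
        E.vals (σ.block src k k) ⟨i, h.2.1⟩
      else σ.real a i j }

/-- `Exec E p σ t τ`: started in `σ`, the program `p` halts in `τ` after exactly `t` steps. A
decomposition of a `k × k` matrix takes `k ^ 3` steps (plus one); everything else takes one step per
elementary operation. -/
inductive Exec (E : EigenSolver) : Prog → State → ℕ → State → Prop
  | skip (σ : State) : Exec E .skip σ 1 σ
  | setVar (σ : State) (v : ℕ) (e : NExp) :
      Exec E (.setVar v e) σ (1 + e.cost) { σ with var := Function.update σ.var v (e.eval σ) }
  | setNat (σ : State) (a : ℕ) (i j e : NExp) :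
      Exec E (.setNat a i j e) σ (1 + i.cost + j.cost + e.cost)
        { σ with nat := put σ.nat a (i.eval σ) (j.eval σ) (e.eval σ) }
  | setReal (σ : State) (a : ℕ) (i j : NExp) (e : RExp) :
      Exec E (.setReal a i j e) σ (1 + i.cost + j.cost + e.cost)
        { σ with real := put σ.real a (i.eval σ) (j.eval σ) (e.eval σ) }
  | eig (σ : State) (k : NExp) (src vals vecs : ℕ) :
      Exec E (.eig k src vals vecs) σ (1 + k.cost + k.eval σ ^ 3)
        (σ.eig E (k.eval σ) src vals vecs)
  | seq {p q : Prog} {σ₁ σ₂ σ₃ : State} {t u : ℕ} :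
      Exec E p σ₁ t σ₂ → Exec E q σ₂ u σ₃ → Exec E (.seq p q) σ₁ (1 + t + u) σ₃
  | iteTrue {b : Test} {p q : Prog} {σ τ : State} {t : ℕ} :
      b.holds σ → Exec E p σ t τ → Exec E (.ite b p q) σ (1 + b.cost + t) τ
  | iteFalse {b : Test} {p q : Prog} {σ τ : State} {t : ℕ} :
      ¬ b.holds σ → Exec E q σ t τ → Exec E (.ite b p q) σ (1 + b.cost + t) τ
  | loopDone {b : Test} {p : Prog} {σ : State} :
      ¬ b.holds σ → Exec E (.loop b p) σ (1 + b.cost) σ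
  | loopStep {b : Test} {p : Prog} {σ₁ σ₂ σ₃ : State} {t u : ℕ} :
      b.holds σ₁ → Exec E p σ₁ t σ₂ → Exec E (.loop b p) σ₂ u σ₃ →
        Exec E (.loop b p) σ₁ (1 + b.cost + t + u) σ₃

/-- Execution is deterministic, so `Exec E p σ t τ` speaks of *the* run of `p` from `σ`. -/
theorem Exec.deterministic {E : EigenSolver} {p : Prog} {σ τ τ' : State} {t t' : ℕ}
    (h : Exec E p σ t τ) (h' : Exec E p σ t' τ') : t = t' ∧ τ = τ' := by
  induction h generalizing t' τ' with
  | skip => cases h'; exact ⟨rfl, rfl⟩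
  | setVar => cases h'; exact ⟨rfl, rfl⟩
  | setNat => cases h'; exact ⟨rfl, rfl⟩
  | setReal => cases h'; exact ⟨rfl, rfl⟩
  | eig => cases h'; exact ⟨rfl, rfl⟩
  | seq _ _ ih₁ ih₂ =>
    cases h' with
    | seq h₁ h₂ =>
      obtain ⟨rfl, rfl⟩ := ih₁ h₁
      obtain ⟨rfl, rfl⟩ := ih₂ h₂
      exact ⟨rfl, rfl⟩
  | iteTrue hb _ ih =>
    cases h' with
    | iteTrue _ h₁ => obtain ⟨rfl, rfl⟩ := ih h₁; exact ⟨rfl, rfl⟩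
    | iteFalse hb' _ => exact absurd hb hb'
  | iteFalse hb _ ih =>
    cases h' with
    | iteTrue hb' _ => exact absurd hb' hb
    | iteFalse _ h₁ => obtain ⟨rfl, rfl⟩ := ih h₁; exact ⟨rfl, rfl⟩
  | loopDone hb =>
    cases h' with
    | loopDone _ => exact ⟨rfl, rfl⟩
    | loopStep hb' _ _ => exact absurd hb' hb
  | loopStep hb _ _ ih₁ ih₂ =>
    cases h' with
    | loopDone hb' => exact absurd hb hb'
    | loopStep _ h₁ h₂ =>
      obtain ⟨rfl, rfl⟩ := ih₁ h₁
      obtain ⟨rfl, rfl⟩ := ih₂ h₂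
      exact ⟨rfl, rfl⟩

/-! ### Input and output conventions -/

/-- The input: `n`, `d`, `s` in the variables `0`, `1`, `2`, the matrix `K` in the leading block of
the real array `0`; the rest of the memory is zero. -/
def inputState {n : ℕ} (d s : ℕ) (K : Matrix (Fin n) (Fin n) ℝ) : State where
  var v := if v = 0 then n else if v = 1 then d else if v = 2 then s else 0
  nat _ _ _ := 0
  real a i j := if h : a = 0 ∧ i < n ∧ j < n then K ⟨i, h.2.1⟩ ⟨j, h.2.2⟩ else 0

/-- The solution that is returned: the leading `n × d` block of the real array `1`. -/
def State.solution (σ : State) (n d : ℕ) : Matrix (Fin n) (Fin d) ℝ :=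
  σ.block 1 n d

/-- The number of candidate supports that are returned: the variable `3`. -/
def State.numCandidates (σ : State) : ℕ :=
  σ.var 3

/-- The candidate support number `k`: its elements are the first `s` entries of row `k` of the array
of naturals `0`. -/
def State.candidate (σ : State) (n s k : ℕ) : Set (Fin n) :=
  {i | ∃ l < s, σ.nat 0 k l = i}

end SPCA

namespace SPCA

-- Factor `K = Bᵀ * B` with exactly `r = K.rank` rows, and write `bᵢ` for the columns of `B`. On a
-- fixed support the best value is the sum of the `d` largest eigenvalues of the principal submatrix
-- (Ky Fan). If `V` consists of the leading `d` left singular vectors of the columns in a support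
-- `c₀`, then `q i = ‖Vᵀ bᵢ‖²` sums to the value of `c₀` over `c₀`, and to at most the value of `c'`
-- over any other support `c'` (`exists_functional`). Take `c₀` optimal: every choice of `s` indices
-- with the largest `q` is then optimal as well. So only the order that such a functional induces
-- near its `s`-th largest value matters.
--
-- The functional is linear in the symmetric tensors `bᵢ ⊗ bᵢ`, which span a space of dimension at
-- most `D = r (r + 1) / 2`. With a pivot `e` at the `s`-th largest value (`exists_threshold`), the
-- signs of `q i - q e` alone determine an admissible selection (`sum_le_of_selectsSigns`). A sign
-- pattern realized in a space of dimension at most `D` is also realized by a vertex: a function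
-- determined by at most `D` of its coordinates, in each of which it equals `-1`, `0` or `1`
-- (`exists_vertex`, `exists_determining_tuple`). Hence `n (3 n) ^ D` choices of pivot, points and
-- values suffice, and a single choice if `r = 0`.
--
-- The function is recovered from these data by the pseudo-inverse of a Gram matrix
-- (`eigenvalue_interpolation`). Its entries are polynomials in the entries of `K`, so no factor `B`
-- is ever computed. Every choice, compatible or not, yields some set of `s` indices; the program
-- lists it, evaluates it and keeps the best. `exists_maximal_candidate` ensures that an optimal one
-- occurs.
--
-- Since `r ^ 2 + r = 2 D`, the count `n (3 n) ^ D` leaves a factor of about `n ^ D` to absorb `3 ^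
-- D`, the cubic cost in `D` and the eigenvalue decompositions of size `s`. This fails only for `r =
-- 1`, where `r ≤ d` and the value of a support is simply a trace. The remaining work is a
-- Hoare-style verification: `Runs` bounds the time, and `Frame` keeps track of untouched memory.

infixr:60 " ;; " => Prog.seq

/-! ### Which parts of the memory a program writes to -/

/-- The variables a program may assign to. -/
def Prog.vars : Prog → List ℕ
  | .skip => []
  | .setVar v _ => [v]
  | .setNat _ _ _ _ => []
  | .setReal _ _ _ _ => []
  | .eig _ _ _ _ => []
  | .seq p q => p.vars ++ q.vars
  | .ite _ p q => p.vars ++ q.vars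
  | .loop _ p => p.vars

/-- The arrays of naturals a program may write to. -/
def Prog.nats : Prog → List ℕ
  | .skip => []
  | .setVar _ _ => []
  | .setNat a _ _ _ => [a]
  | .setReal _ _ _ _ => []
  | .eig _ _ _ _ => []
  | .seq p q => p.nats ++ q.nats
  | .ite _ p q => p.nats ++ q.nats
  | .loop _ p => p.nats

/-- The arrays of reals a program may write to. -/
def Prog.reals : Prog → List ℕ
  | .skip => []
  | .setVar _ _ => []
  | .setNat _ _ _ _ => []
  | .setReal a _ _ _ => [a]
  | .eig _ _ vals vecs => [vals, vecs]
  | .seq p q => p.reals ++ q.reals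
  | .ite _ p q => p.reals ++ q.reals
  | .loop _ p => p.reals

/-- `τ` agrees with `σ` on everything that `p` does not write to. -/
structure Frame (p : Prog) (σ τ : State) : Prop where
  var : ∀ v, v ∉ p.vars → τ.var v = σ.var v
  nat : ∀ a, a ∉ p.nats → τ.nat a = σ.nat a
  real : ∀ a, a ∉ p.reals → τ.real a = σ.real a

theorem Frame.refl (p : Prog) (σ : State) : Frame p σ σ :=
  ⟨fun _ _ => rfl, fun _ _ => rfl, fun _ _ => rfl⟩

theorem Frame.trans {p : Prog} {σ τ υ : State} (h : Frame p σ τ) (h' : Frame p τ υ) :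
    Frame p σ υ :=
  ⟨fun v hv => (h'.var v hv).trans (h.var v hv), fun a ha => (h'.nat a ha).trans (h.nat a ha),
    fun a ha => (h'.real a ha).trans (h.real a ha)⟩

theorem Frame.mono {p q : Prog} {σ τ : State} (h : Frame p σ τ) (hv : p.vars ⊆ q.vars)
    (hn : p.nats ⊆ q.nats) (hr : p.reals ⊆ q.reals) : Frame q σ τ :=
  ⟨fun v h' => h.var v fun h'' => h' (hv h''), fun v h' => h.nat v fun h'' => h' (hn h''),
    fun v h' => h.real v fun h'' => h' (hr h'')⟩

/-- The write sets are syntactic, so for a concrete program the preservation of a variable or an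
array becomes a decidable list membership. -/
theorem Exec.frame {E : EigenSolver} {p : Prog} {σ τ : State} {t : ℕ} (h : Exec E p σ t τ) :
    Frame p σ τ := by
  induction h with
  | skip => exact .refl _ _
  | setVar σ v e =>
    refine ⟨fun w hw => ?_, fun _ _ => rfl, fun _ _ => rfl⟩
    exact Function.update_of_ne (by simpa [Prog.vars] using hw) _ _
  | setNat σ a i j e =>
    refine ⟨fun _ _ => rfl, fun b hb => ?_, fun _ _ => rfl⟩
    have : b ≠ a := by simpa [Prog.nats] using hb
    funext x y
    simp [put, this]
  | setReal σ a i j e =>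
    refine ⟨fun _ _ => rfl, fun _ _ => rfl, fun b hb => ?_⟩
    have : b ≠ a := by simpa [Prog.reals] using hb
    funext x y
    simp [put, this]
  | eig σ k src vals vecs =>
    refine ⟨fun _ _ => rfl, fun _ _ => rfl, fun b hb => ?_⟩
    have : b ≠ vals ∧ b ≠ vecs := by simpa [Prog.reals] using hb
    funext x y
    simp [State.eig, this.1, this.2]
  | seq _ _ ih₁ ih₂ =>
    exact (ih₁.mono (by simp [Prog.vars]) (by simp [Prog.nats]) (by simp [Prog.reals])).trans
      (ih₂.mono (by simp [Prog.vars]) (by simp [Prog.nats]) (by simp [Prog.reals]))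
  | iteTrue _ _ ih =>
    exact ih.mono (by simp [Prog.vars]) (by simp [Prog.nats]) (by simp [Prog.reals])
  | iteFalse _ _ ih =>
    exact ih.mono (by simp [Prog.vars]) (by simp [Prog.nats]) (by simp [Prog.reals])
  | loopDone => exact .refl _ _
  | loopStep _ _ _ ih₁ ih₂ =>
    exact (ih₁.mono (by simp [Prog.vars]) (by simp [Prog.nats]) (by simp [Prog.reals])).trans ih₂

/-! ### Total correctness with a time bound -/

/-- Started in `σ`, the program `p` halts after at most `T` steps in a state satisfying `Q`. -/
def Runs (E : EigenSolver) (p : Prog) (σ : State) (T : ℕ) (Q : State → Prop) : Prop :=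
  ∃ t τ, Exec E p σ t τ ∧ t ≤ T ∧ Q τ

namespace Runs

variable {E : EigenSolver} {p q : Prog} {σ : State} {T T' T₁ T₂ : ℕ} {Q Q' : State → Prop}

/-- The frame is handed to the new postcondition, so a specification of `p` need not mention the
memory that `p` leaves alone. -/
theorem mono (h : Runs E p σ T Q) (hT : T ≤ T') (hQ : ∀ τ, Frame p σ τ → Q τ → Q' τ) :
    Runs E p σ T' Q' := by
  obtain ⟨t, τ, h₁, h₂, h₃⟩ := h
  exact ⟨t, τ, h₁, h₂.trans hT, hQ _ h₁.frame h₃⟩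

theorem le (h : Runs E p σ T Q) (hT : T ≤ T') : Runs E p σ T' Q :=
  h.mono hT fun _ _ h => h

theorem skip (h : Q σ) : Runs E .skip σ 1 Q := ⟨_, _, .skip _, le_rfl, h⟩

theorem setVar {v : ℕ} {e : NExp}
    (h : Q { σ with var := Function.update σ.var v (e.eval σ) }) :
    Runs E (.setVar v e) σ (1 + e.cost) Q := ⟨_, _, .setVar _ _ _, le_rfl, h⟩

theorem setNat {a : ℕ} {i j e : NExp}
    (h : Q { σ with nat := put σ.nat a (i.eval σ) (j.eval σ) (e.eval σ) }) :
    Runs E (.setNat a i j e) σ (1 + i.cost + j.cost + e.cost) Q :=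
  ⟨_, _, .setNat _ _ _ _ _, le_rfl, h⟩

theorem setReal {a : ℕ} {i j : NExp} {e : RExp}
    (h : Q { σ with real := put σ.real a (i.eval σ) (j.eval σ) (e.eval σ) }) :
    Runs E (.setReal a i j e) σ (1 + i.cost + j.cost + e.cost) Q :=
  ⟨_, _, .setReal _ _ _ _ _, le_rfl, h⟩

theorem eig {k : NExp} {src vals vecs : ℕ} {N : ℕ} (hN : k.eval σ = N)
    (h : Q (σ.eig E N src vals vecs)) :
    Runs E (.eig k src vals vecs) σ (1 + k.cost + N ^ 3) Q := by
  subst hN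
  exact ⟨_, _, .eig _ _ _ _ _, le_rfl, h⟩

theorem seq (h : Runs E p σ T₁ fun τ => Runs E q τ T₂ Q) :
    Runs E (p ;; q) σ (1 + T₁ + T₂) Q := by
  obtain ⟨t, τ, h₁, h₂, t', τ', h₃, h₄, h₅⟩ := h
  exact ⟨_, τ', .seq h₁ h₃, by omega, h₅⟩

/-- Both branches are charged, which costs only constants. An impossible branch may be given time
`0`, its hypothesis being contradictory. -/
theorem ite {b : Test} (h₁ : b.holds σ → Runs E p σ T₁ Q) (h₂ : ¬ b.holds σ → Runs E q σ T₂ Q) :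
    Runs E (.ite b p q) σ (1 + b.cost + T₁ + T₂) Q := by
  by_cases hb : b.holds σ
  · obtain ⟨t, τ, h₃, h₄, h₅⟩ := h₁ hb
    exact ⟨_, τ, .iteTrue hb h₃, by omega, h₅⟩
  · obtain ⟨t, τ, h₃, h₄, h₅⟩ := h₂ hb
    exact ⟨_, τ, .iteFalse hb h₃, by omega, h₅⟩

/-- The rule for a loop whose body is executed exactly `N` times. -/
theorem loop {b : Test} (N : ℕ) (I : ℕ → State → Prop) (h₀ : I 0 σ)
    (hstep : ∀ k < N, ∀ τ, Frame p σ τ → I k τ → b.holds τ ∧ Runs E p τ T (I (k + 1)))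
    (hend : ∀ τ, Frame p σ τ → I N τ → ¬ b.holds τ) :
    Runs E (.loop b p) σ ((N + 1) * (T + b.cost + 1)) (I N) := by
  suffices H : ∀ m k, k + m = N → ∀ τ, Frame p σ τ → I k τ →
      Runs E (.loop b p) τ ((m + 1) * (T + b.cost + 1)) (I N) from
    H N 0 (by omega) σ (.refl _ _) h₀
  intro m
  induction m with
  | zero =>
    intro k hk τ hF hI
    obtain rfl : k = N := hk
    exact ⟨_, τ, .loopDone (hend _ hF hI), by omega, hI⟩
  | succ m ih =>
    intro k hk τ hF hI
    obtain ⟨hb, t, τ', h₁, h₂, h₃⟩ := hstep k (by omega) τ hF hI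
    obtain ⟨t', τ'', h₄, h₅, h₆⟩ := ih (k + 1) (by omega) τ' (hF.trans h₁.frame) h₃
    refine ⟨_, τ'', .loopStep hb h₁ h₄, ?_, h₆⟩
    have : (m + 1 + 1) * (T + b.cost + 1) = (m + 1) * (T + b.cost + 1) + (T + b.cost + 1) := by
      ring
    omega

end Runs

/-! ### Counting loops -/

/-- `for i = 0, …, b - 1 do p`, where `i` and `b` are variables. -/
def Prog.for (i b : ℕ) (p : Prog) : Prog :=
  .setVar i (.const 0) ;;
    .loop (.not (.nle (.var b) (.var i))) (p ;; .setVar i (.add (.var i) (.const 1)))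

@[simp] theorem Prog.vars_for (i b : ℕ) (p : Prog) :
    (Prog.for i b p).vars = i :: (p.vars ++ [i]) := rfl

@[simp] theorem Prog.nats_for (i b : ℕ) (p : Prog) : (Prog.for i b p).nats = p.nats := by
  simp [Prog.for, Prog.nats]

@[simp] theorem Prog.reals_for (i b : ℕ) (p : Prog) : (Prog.for i b p).reals = p.reals := by
  simp [Prog.for, Prog.reals]

/-- The counter is incremented after the body, so the invariant must be insensitive to it (`hI`);
the body instead receives its value as a separate hypothesis. The factor `20` with `1 ≤ T` absorbs
the overhead of the test and the increment. -/
theorem Runs.for {E : EigenSolver} {i b : ℕ} {p : Prog} {σ : State} {T N : ℕ}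
    (I : ℕ → State → Prop) (hN : σ.var b = N) (hb : b ∉ i :: p.vars) (hi : i ∉ p.vars)
    (hT : 1 ≤ T)
    (hI : ∀ k τ x, I k τ → I k { τ with var := Function.update τ.var i x })
    (h₀ : I 0 σ)
    (hstep : ∀ k < N, ∀ τ, Frame (Prog.for i b p) σ τ → τ.var i = k → I k τ →
      Runs E p τ T (I (k + 1))) :
    Runs E (Prog.for i b p) σ (20 * (N + 1) * T) (I N) := by
  have hbi : b ≠ i := fun h => hb (by simp [h])
  have hbp : b ∉ p.vars := fun h => hb (by simp [h])
  have key : Runs E (Prog.for i b p) σ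
      (1 + (1 + 1) + (N + 1) * ((1 + T + (1 + 3)) + 4 + 1)) (I N) := by
    refine .seq (.setVar ?_)
    refine (Runs.loop N (fun k τ => τ.var i = k ∧ τ.var b = N ∧ I k τ) ?_ ?_ ?_).mono le_rfl
      fun _ _ h => h.2.2
    · exact ⟨by simp [NExp.eval], by simp [hbi, hN], hI _ _ _ h₀⟩
    · rintro k hk τ hF ⟨h₁, h₂, h₃⟩
      refine ⟨by simp [Test.holds, NExp.eval, h₁, h₂, hk], .seq ?_⟩
      have hF' : Frame (Prog.for i b p) σ τ := by
        refine ⟨fun v hv => ?_, fun a ha => ?_, fun a ha => ?_⟩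
        · rw [hF.var v (by simp [Prog.vars] at hv ⊢; tauto)]
          exact Function.update_of_ne (by simp at hv; tauto) _ _
        · exact hF.nat a (by simpa [Prog.nats] using ha)
        · exact hF.real a (by simpa [Prog.reals] using ha)
      refine (hstep k hk τ hF' h₁ h₃).mono le_rfl fun τ' hF₁ hI' => .setVar ⟨?_, ?_, hI _ _ _ hI'⟩
      · simp [NExp.eval, hF₁.var i hi, h₁]
      · simp [hbi, hF₁.var b hbp, h₂]
    · rintro τ - ⟨h₁, h₂, -⟩
      simp [Test.holds, NExp.eval, h₁, h₂]
  refine key.le ?_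
  nlinarith [Nat.zero_le N, Nat.zero_le (N * (T - 1)), Nat.mul_le_mul_left N hT]

/-! ### Sums, matrix filling and decompositions as program fragments -/

/-- The scalar in which sums are accumulated. -/
def State.acc (σ : State) : ℝ := σ.real 6 0 0

/-- Reset the accumulator. -/
def Prog.zeroAcc : Prog := .setReal 6 (.const 0) (.const 0) (.const 0)

theorem Runs.zeroAcc {E : EigenSolver} {σ : State} :
    Runs E .zeroAcc σ 4 (fun τ => τ.acc = 0) :=
  Runs.setReal (by simp [State.acc, put, NExp.eval, RExp.eval])

/-- Add the value of an expression to the accumulator. -/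
def Prog.accum (e : RExp) : Prog :=
  .setReal 6 (.const 0) (.const 0) (.add (.get 6 (.const 0) (.const 0)) e)

theorem Runs.accum {E : EigenSolver} {σ : State} {e : RExp} {x : ℝ} (h : e.eval σ = x) :
    Runs E (.accum e) σ (7 + e.cost) (fun τ => τ.acc = σ.acc + x) := by
  refine Runs.le (Runs.setReal ?_) (by simp [NExp.cost, RExp.cost]; omega)
  simp [State.acc, put, NExp.eval, RExp.eval, h]

/-- A loop whose body adds to the accumulator computes a sum. -/
theorem Runs.forSum {E : EigenSolver} {i b : ℕ} {p : Prog} {σ : State} {T N : ℕ} (f : Fin N → ℝ)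
    (hN : σ.var b = N) (hb : b ∉ i :: p.vars) (hi : i ∉ p.vars) (hT : 1 ≤ T)
    (hstep : ∀ k : Fin N, ∀ τ, Frame (Prog.for i b p) σ τ → τ.var i = k →
      Runs E p τ T (fun τ' => τ'.acc = τ.acc + f k)) :
    Runs E (Prog.for i b p) σ (20 * (N + 1) * T) (fun τ => τ.acc = σ.acc + ∑ k, f k) := by
  have hsum : ∑ k, f k = ∑ k ∈ Finset.range N, if h : k < N then f ⟨k, h⟩ else 0 := by
    rw [Finset.sum_range]
    simp
  rw [hsum]
  refine Runs.for (fun k τ => τ.acc = σ.acc + ∑ k ∈ Finset.range k,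
    if h : k < N then f ⟨k, h⟩ else 0) hN hb hi hT (fun _ _ _ h => h) (by simp) ?_
  intro k hk τ hF hi' hI
  refine (hstep ⟨k, hk⟩ τ hF hi').mono le_rfl fun τ' _ h => ?_
  rw [h, hI, Finset.sum_range_succ, dif_pos hk, add_assoc]

/-- Fill the leading block of array `a`, with as many rows and columns as the variable `b` says. -/
def Prog.fill (a b : ℕ) (e : RExp) : Prog :=
  .for 10 b (.for 11 b (.setReal a (.var 10) (.var 11) e))

/-- A frame says nothing about the contents of `a`, so `he` forces the value of `e` to be
independent of the array that is being filled. -/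
theorem Runs.fill {E : EigenSolver} {a b : ℕ} {e : RExp} {σ : State} {N : ℕ}
    (f : Fin N → Fin N → ℝ) (hN : σ.var b = N) (hb : b ≠ 10 ∧ b ≠ 11)
    (he : ∀ τ, Frame (.fill a b e) σ τ → ∀ i j : Fin N, τ.var 10 = i → τ.var 11 = j →
      e.eval τ = f i j) :
    Runs E (.fill a b e) σ (400 * (N + 1) ^ 2 * (3 + e.cost))
      (fun τ => ∀ i j : Fin N, τ.real a i j = f i j) := by
  have key := Runs.for (E := E) (σ := σ) (i := 10) (b := b)
    (p := .for 11 b (.setReal a (.var 10) (.var 11) e)) (T := 20 * (N + 1) * (3 + e.cost))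
    (fun k τ => ∀ i j : Fin N, (i : ℕ) < k → τ.real a i j = f i j) hN
    (by simp [Prog.vars, hb.1, hb.2]) (by simp [Prog.vars]) (by nlinarith)
    (fun _ _ _ h => h) (by simp) ?_
  · exact key.mono (le_of_eq (by ring)) fun τ _ h i j => h i j i.2
  intro k hk τ hF h10 hI
  have hbN : τ.var b = N := by rw [hF.var b (by simp [Prog.vars, hb.1, hb.2]), hN]
  refine (Runs.for (E := E) (σ := τ) (i := 11) (b := b) (T := 3 + e.cost)
    (fun l τ => (∀ i j : Fin N, (i : ℕ) < k → τ.real a i j = f i j) ∧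
      ∀ j : Fin N, (j : ℕ) < l → τ.real a k j = f ⟨k, hk⟩ j) hbN
    (by simp [Prog.vars, hb.2]) (by simp [Prog.vars]) (by omega)
    (fun _ _ _ h => h) ⟨hI, by simp⟩ ?_).mono le_rfl ?_
  · rintro l hl τ' hF' h11 ⟨hI₁, hI₂⟩
    have h10' : τ'.var 10 = k := by rw [hF'.var 10 (by simp [Prog.vars]), h10]
    have hev : e.eval τ' = f ⟨k, hk⟩ ⟨l, hl⟩ := by
      refine he τ' (hF.trans ?_) _ _ h10' h11
      exact hF'.mono (by simp [Prog.vars]) (by simp [Prog.nats]) (by simp [Prog.reals])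
    refine Runs.le (Runs.setReal ⟨?_, ?_⟩) (by simp [NExp.cost])
    · intro i j hi
      have : (i : ℕ) ≠ k := hi.ne
      simpa [put, NExp.eval, h10', this] using hI₁ i j hi
    · intro j hj
      by_cases hjl : (j : ℕ) = l
      · obtain rfl : j = ⟨l, hl⟩ := Fin.ext hjl
        simp [put, NExp.eval, h10', h11, hev]
      · simpa [put, NExp.eval, h10', h11, hjl] using hI₂ j (by omega)
  · rintro τ' - ⟨hI₁, hI₂⟩ i j hi
    rcases Nat.lt_succ_iff_lt_or_eq.1 hi with h | h
    · exact hI₁ i j h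
    · obtain rfl : i = ⟨k, hk⟩ := Fin.ext h
      exact hI₂ j j.2

/-- Naming the matrix `M` apart from the memory keeps the output meaningful after the source array
is overwritten. -/
theorem Runs.eig' {E : EigenSolver} {σ : State} {k : NExp} {src vals vecs N : ℕ}
    (M : Matrix (Fin N) (Fin N) ℝ) (hN : k.eval σ = N) (hne : vals ≠ vecs)
    (hM : ∀ i j : Fin N, σ.real src i j = M i j) :
    Runs E (.eig k src vals vecs) σ (1 + k.cost + N ^ 3) (fun τ =>
      (∀ j : Fin N, τ.real vals j 0 = E.vals M j) ∧
        ∀ i j : Fin N, τ.real vecs i j = E.vecs M i j) := by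
  have hblock : σ.block src N N = M := by
    ext i j
    exact hM i j
  refine .eig hN ⟨fun j => ?_, fun i j => ?_⟩
  · simp [State.eig, hne, hblock]
  · simp [State.eig, hblock]

/-! ### Sums of the largest eigenvalues -/

/-- The sum of the first `d` entries of `w`. -/
def topSum {k : ℕ} (w : Fin k → ℝ) {d : ℕ} (h : d ≤ k) : ℝ := ∑ l : Fin d, w (Fin.castLE h l)

theorem sum_ite_lt {k d : ℕ} (h : d ≤ k) (w : Fin k → ℝ) :
    ∑ l : Fin k, (if (l : ℕ) < d then w l else 0) = topSum w h := by
  obtain ⟨e, rfl⟩ := Nat.exists_eq_add_of_le h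
  rw [Fin.sum_univ_add]
  simp [topSum, Fin.castLE]
  rfl

/-- This is the fractional knapsack bound. Subtracting a threshold `θ` between the first `d` weights
and the others makes the former contribute at most `w j - θ` and the latter at most `0`. -/
theorem sum_mul_le_topSum {k d : ℕ} (h : d ≤ k) {w p : Fin k → ℝ} (hw : Antitone w)
    (hw0 : ∀ j, 0 ≤ w j) (hp0 : ∀ j, 0 ≤ p j) (hp1 : ∀ j, p j ≤ 1) (hp : ∑ j, p j ≤ d) :
    ∑ j, w j * p j ≤ topSum w h := by
  -- The threshold is the first omitted weight, or `0` if none is omitted. Its nonnegativity is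
  -- needed because the `p j` sum to at most `d`, not exactly `d`.
  obtain ⟨θ, hθ0, hθ₁, hθ₂⟩ : ∃ θ : ℝ, 0 ≤ θ ∧ (∀ j : Fin k, (j : ℕ) < d → θ ≤ w j) ∧
      ∀ j : Fin k, d ≤ j → w j ≤ θ := by
    by_cases hd : d < k
    · exact ⟨w ⟨d, hd⟩, hw0 _, fun j hj => hw (Fin.le_def.2 hj.le),
        fun j hj => hw (Fin.le_def.2 hj)⟩
    · exact ⟨0, le_rfl, fun j _ => hw0 j, fun j hj => absurd j.2 (by omega)⟩
  have hterm : ∀ j : Fin k, w j * p j ≤ (if (j : ℕ) < d then w j - θ else 0) + θ * p j := by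
    intro j
    split_ifs with hj
    · nlinarith [hθ₁ j hj, hp1 j]
    · nlinarith [hθ₂ j (by omega), hp0 j]
  calc ∑ j, w j * p j ≤ ∑ j : Fin k, ((if (j : ℕ) < d then w j - θ else 0) + θ * p j) :=
        Finset.sum_le_sum fun j _ => hterm j
    _ = topSum (fun j => w j - θ) h + θ * ∑ j, p j := by
        rw [Finset.sum_add_distrib, sum_ite_lt h (fun j => w j - θ), Finset.mul_sum]
    _ ≤ topSum w h := by
        have : topSum (fun j => w j - θ) h = topSum w h - d * θ := by
          simp [topSum, Finset.sum_sub_distrib]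
        nlinarith

/-- Expand `‖x - V Vᵀ x‖² ≥ 0`. The columns are only asked to be orthogonal of norm at most one,
because normalized singular vectors with singular value `0` will be zero columns. -/
theorem bessel {ι κ : Type*} [Fintype ι] [Fintype κ] [DecidableEq κ] {V : Matrix ι κ ℝ}
    {ε : κ → ℝ} (hV : Vᵀ * V = diagonal ε) (hε : ∀ k, ε k ≤ 1) (x : ι → ℝ) :
    ∑ k, (∑ i, x i * V i k) ^ 2 ≤ ∑ i, x i ^ 2 := by
  set y : κ → ℝ := x ᵥ* V with hy
  have h₁ : 0 ≤ (x - V *ᵥ y) ⬝ᵥ (x - V *ᵥ y) := by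
    simp only [dotProduct]
    exact Finset.sum_nonneg fun i _ => mul_self_nonneg _
  have h₂ : x ⬝ᵥ V *ᵥ y = y ⬝ᵥ y := by rw [dotProduct_mulVec]
  have h₃ : (V *ᵥ y) ⬝ᵥ (V *ᵥ y) = ∑ k, ε k * y k ^ 2 := by
    rw [dotProduct_mulVec, ← mulVec_transpose, mulVec_mulVec, hV]
    simp only [dotProduct, mulVec_diagonal]
    exact Finset.sum_congr rfl fun k _ => by ring
  have h₄ : ∑ k, ε k * y k ^ 2 ≤ y ⬝ᵥ y := by
    simp only [dotProduct]
    exact Finset.sum_le_sum fun k _ => by nlinarith [hε k, sq_nonneg (y k)]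
  have h₅ : y ⬝ᵥ y = ∑ k, (∑ i, x i * V i k) ^ 2 := by
    simp only [dotProduct, hy, vecMul, sq]
  have h₆ : x ⬝ᵥ x = ∑ i, x i ^ 2 := by simp only [dotProduct, sq]
  rw [← h₅, ← h₆]
  rw [sub_dotProduct, dotProduct_sub, dotProduct_sub, dotProduct_comm (V *ᵥ y) x, h₂, h₃] at h₁
  linarith

/-- The squared inner products form a doubly substochastic array: Bessel for `V` bounds the weight
of each `j` by `1`, Bessel for `W` bounds the total by `d`, and the knapsack bound applies. -/
theorem sum_mul_sq_le_topSum {n k d : ℕ} (h : d ≤ k) {w : Fin k → ℝ} (hw : Antitone w)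
    (hw0 : ∀ j, 0 ≤ w j) {W : Matrix (Fin n) (Fin k) ℝ} {V : Matrix (Fin n) (Fin d) ℝ}
    {ε : Fin k → ℝ} {δ : Fin d → ℝ} (hW : Wᵀ * W = diagonal ε) (hε : ∀ j, ε j ≤ 1)
    (hV : Vᵀ * V = diagonal δ) (hδ : ∀ j, δ j ≤ 1) :
    ∑ j, w j * ∑ l, (∑ i, W i j * V i l) ^ 2 ≤ topSum w h := by
  have hnorm : ∀ {m : ℕ} {A : Matrix (Fin n) (Fin m) ℝ} {η : Fin m → ℝ}, Aᵀ * A = diagonal η →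
      ∀ j, ∑ i, A i j ^ 2 = η j := by
    intro m A η hA j
    have := congrFun (congrFun hA j) j
    simpa [mul_apply, sq] using this
  refine sum_mul_le_topSum h hw hw0 (fun j => Finset.sum_nonneg fun l _ => sq_nonneg _)
    (fun j => ?_) ?_
  · exact (bessel hV hδ fun i => W i j).trans ((hnorm hW j).le.trans (hε j))
  · rw [Finset.sum_comm]
    calc ∑ l, ∑ j, (∑ i, W i j * V i l) ^ 2 ≤ ∑ l : Fin d, (1 : ℝ) := by
          refine Finset.sum_le_sum fun l _ => ?_
          have := (bessel hW hε fun i => V i l).trans ((hnorm hV l).le.trans (hδ l))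
          simpa [mul_comm] using this
      _ = d := by simp

/-! ### Spectral consequences of a decomposition; Ky Fan's inequality -/

namespace EigenSolver

variable (E : EigenSolver) {k : ℕ} {M : Matrix (Fin k) (Fin k) ℝ}

theorem vecs_mul_transpose (hM : M.IsSymm) : E.vecs M * (E.vecs M)ᵀ = 1 :=
  mul_eq_one_comm.1 (E.orthonormal_vecs M hM)

theorem eq_mul (hM : M.IsSymm) : M = E.vecs M * diagonal (E.vals M) * (E.vecs M)ᵀ := by
  rw [← E.decomposition M hM, Matrix.mul_assoc, E.vecs_mul_transpose hM, Matrix.mul_one]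

theorem transpose_mul_mul (hM : M.IsSymm) :
    (E.vecs M)ᵀ * M * E.vecs M = diagonal (E.vals M) := by
  rw [Matrix.mul_assoc, E.decomposition M hM, ← Matrix.mul_assoc, E.orthonormal_vecs M hM,
    Matrix.one_mul]

theorem vals_nonneg (hM : M.PosSemidef) (j : Fin k) : 0 ≤ E.vals M j := by
  have hs : M.IsSymm := by simpa [IsSymm, IsHermitian] using hM.1
  have h := (hM.conjTranspose_mul_mul_same (E.vecs M)).diag_nonneg (i := j)
  rw [conjTranspose_eq_transpose_of_trivial, E.transpose_mul_mul hs] at h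
  simpa using h

theorem rank_eq (hM : M.IsSymm) : M.rank = Fintype.card {j // E.vals M j ≠ 0} := by
  have h₁ : IsUnit (E.vecs M).det :=
    isUnit_det_of_left_inverse (E.orthonormal_vecs M hM)
  have h₂ : IsUnit ((E.vecs M)ᵀ).det := by rwa [det_transpose]
  conv_lhs => rw [E.eq_mul hM]
  rw [rank_mul_eq_left_of_isUnit_det _ _ h₂, rank_mul_eq_right_of_isUnit_det _ _ h₁,
    rank_diagonal]

theorem trace_eq (hM : M.IsSymm) : M.trace = ∑ j, E.vals M j := by
  conv_lhs => rw [E.eq_mul hM]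
  rw [Matrix.trace_mul_comm, ← Matrix.mul_assoc, E.orthonormal_vecs M hM, Matrix.one_mul, trace_diagonal]

/-- If the rank is at most `d`, the sum of the `d` largest eigenvalues is the trace. -/
theorem topSum_eq_trace (hM : M.PosSemidef) {d : ℕ} (h : d ≤ k) (hr : M.rank ≤ d) :
    topSum (E.vals M) h = M.trace := by
  have hs : M.IsSymm := by simpa [IsSymm, IsHermitian] using hM.1
  rw [E.trace_eq hs, ← sum_ite_lt]
  refine Finset.sum_congr rfl fun j _ => ?_
  split_ifs with hj
  · rfl
  by_contra hne
  have hpos : 0 < E.vals M j := lt_of_le_of_ne (E.vals_nonneg hM j) hne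
  -- A positive eigenvalue at a position `j ≥ d` makes all those at positions `0, …, j` positive, so
  -- the rank would exceed `d`.
  have hinj : Fintype.card (Fin (j + 1)) ≤ Fintype.card {j // E.vals M j ≠ 0} :=
    Fintype.card_le_of_injective
      (fun i => ⟨Fin.castLE j.2 i, (hpos.trans_le (E.antitone_vals M hs
        (Fin.le_def.2 (Nat.lt_succ_iff.1 i.2)))).ne'⟩)
      (fun a b hab => by simpa using hab)
  rw [← E.rank_eq hs, Fintype.card_fin] at hinj
  omega

/-- Ky Fan: in the eigenbasis the trace is the sum of the eigenvalues weighted by the squared inner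
products of eigenvectors with columns of `Z`. -/
theorem trace_le_topSum (hM : M.PosSemidef) {d : ℕ} (h : d ≤ k) {Z : Matrix (Fin k) (Fin d) ℝ}
    (hZ : Zᵀ * Z = 1) : (Zᵀ * M * Z).trace ≤ topSum (E.vals M) h := by
  have hs : M.IsSymm := by simpa [IsSymm, IsHermitian] using hM.1
  have := sum_mul_sq_le_topSum h (E.antitone_vals M hs) (E.vals_nonneg hM)
    (W := E.vecs M) (V := Z) (ε := fun _ => 1) (δ := fun _ => 1)
    (by rw [E.orthonormal_vecs M hs, diagonal_one]) (fun _ => le_rfl)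
    (by rw [hZ, diagonal_one]) (fun _ => le_rfl)
  refine le_of_eq_of_le ?_ this
  have hY : Zᵀ * M * Z = ((E.vecs M)ᵀ * Z)ᵀ * diagonal (E.vals M) * ((E.vecs M)ᵀ * Z) := by
    conv_lhs => rw [E.eq_mul hs]
    simp only [transpose_mul, transpose_transpose, Matrix.mul_assoc]
  rw [hY]
  simp only [trace, diag_apply, mul_apply, transpose_apply, diagonal_apply, mul_ite, mul_zero,
    Finset.sum_ite_eq', Finset.mem_univ, if_true]
  rw [Finset.sum_comm]
  refine Finset.sum_congr rfl fun j _ => ?_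
  rw [Finset.mul_sum]
  exact Finset.sum_congr rfl fun l _ => by ring

end EigenSolver

/-! ### Restriction to a support -/

/-- The value of the support enumerated by `c`: the sum of the `d` largest eigenvalues of the
principal submatrix of `K` with these rows and columns. -/
noncomputable def supportValue (E : EigenSolver) {n s d : ℕ} (K : Matrix (Fin n) (Fin n) ℝ)
    (h : d ≤ s) (c : Fin s → Fin n) : ℝ :=
  topSum (E.vals (K.submatrix c c)) h

section support

variable {n s d : ℕ} {K : Matrix (Fin n) (Fin n) ℝ} {c : Fin s → Fin n}

theorem transpose_mul_self_restrict (hc : c.Injective) {Z : Matrix (Fin n) (Fin d) ℝ}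
    (hZ : rowSupport Z ⊆ Set.range c) :
    (Z.submatrix c id)ᵀ * Z.submatrix c id = Zᵀ * Z := by
  have h0 : ∀ i ∉ Set.range c, ∀ j, Z i j = 0 := fun i hi j => by
    by_contra h
    exact hi (hZ ⟨j, h⟩)
  ext i j
  simp only [mul_apply, transpose_apply, submatrix_apply, id]
  exact Fintype.sum_of_injective c hc _ _ (fun i hi => by simp [h0 i hi]) fun _ => rfl

theorem transpose_mul_mul_restrict (hc : c.Injective) {Z : Matrix (Fin n) (Fin d) ℝ}
    (hZ : rowSupport Z ⊆ Set.range c) :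
    (Z.submatrix c id)ᵀ * K.submatrix c c * Z.submatrix c id = Zᵀ * K * Z := by
  have h0 : ∀ i ∉ Set.range c, ∀ j, Z i j = 0 := fun i hi j => by
    by_contra h
    exact hi (hZ ⟨j, h⟩)
  ext i j
  simp only [mul_apply, transpose_apply, submatrix_apply, id]
  refine Fintype.sum_of_injective c hc _ _ (fun i hi => by simp [h0 i hi]) fun l => ?_
  congr 1
  exact Fintype.sum_of_injective c hc _ _ (fun i hi => by simp [h0 i hi]) fun _ => rfl

theorem trace_le_supportValue (E : EigenSolver) (hK : K.PosSemidef) (h : d ≤ s)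
    (hc : c.Injective) {Z : Matrix (Fin n) (Fin d) ℝ} (hZ : rowSupport Z ⊆ Set.range c)
    (hZ1 : Zᵀ * Z = 1) : (Zᵀ * K * Z).trace ≤ supportValue E K h c := by
  rw [← transpose_mul_mul_restrict hc hZ]
  exact E.trace_le_topSum (hK.submatrix c) h (by rw [transpose_mul_self_restrict hc hZ, hZ1])

theorem exists_rowSupport_subset_range (hs : s ≤ n) {Z : Matrix (Fin n) (Fin d) ℝ}
    (hZ : (rowSupport Z).ncard ≤ s) :
    ∃ c : Fin s → Fin n, c.Injective ∧ rowSupport Z ⊆ Set.range c := by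
  classical
  obtain ⟨A, hA, hcard⟩ := Finset.exists_superset_card_eq (s := (rowSupport Z).toFinset) (n := s)
    (by rwa [← Set.ncard_eq_toFinset_card']) (by simpa using hs)
  refine ⟨A.orderEmbOfFin hcard, (A.orderEmbOfFin hcard).injective, ?_⟩
  rw [Finset.range_orderEmbOfFin]
  intro i hi
  exact hA (by simpa using hi)

theorem ncard_range (hc : c.Injective) : (Set.range c).ncard = s := by
  rw [← Set.image_univ, Set.ncard_image_of_injective _ hc, Set.ncard_univ, Nat.card_fin]

/-- The eigenvectors of the principal submatrix on the support of largest value form an optimal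
solution. -/
theorem isOptimal_of_eigenvectors (E : EigenSolver) (hK : K.PosSemidef) (h : d ≤ s) (hs : s ≤ n)
    (hc : c.Injective) (hmax : ∀ c' : Fin s → Fin n, c'.Injective →
      supportValue E K h c' ≤ supportValue E K h c)
    {X : Matrix (Fin n) (Fin d) ℝ} (hX : rowSupport X ⊆ Set.range c)
    (hXc : ∀ l j, X (c l) j = E.vecs (K.submatrix c c) l (Fin.castLE h j)) :
    IsOptimal K s X := by
  have hM : (K.submatrix c c).IsSymm := by
    simpa [IsSymm, IsHermitian] using (hK.submatrix c).1
  have hsub : X.submatrix c id = (E.vecs (K.submatrix c c)).submatrix id (Fin.castLE h) := by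
    ext l j
    exact hXc l j
  refine ⟨⟨?_, ?_⟩, fun Z hZ => ?_⟩
  · rw [← transpose_mul_self_restrict hc hX, hsub]
    ext i j
    have := congrFun (congrFun (E.orthonormal_vecs _ hM) (Fin.castLE h i)) (Fin.castLE h j)
    simpa [mul_apply, one_apply] using this
  · exact (Set.ncard_le_ncard hX (Set.toFinite _)).trans (ncard_range hc).le
  · obtain ⟨c', hc', hZc'⟩ := exists_rowSupport_subset_range hs hZ.2
    refine (trace_le_supportValue E hK h hc' hZc' hZ.1).trans ((hmax c' hc').trans (le_of_eq ?_))
    rw [← transpose_mul_mul_restrict hc hX, hsub, supportValue, topSum]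
    refine Finset.sum_congr rfl fun l _ => ?_
    have := congrFun (congrFun (E.transpose_mul_mul hM) (Fin.castLE h l)) (Fin.castLE h l)
    simpa [mul_apply] using this.symm

end support

/-! ### Quadratic functionals that expose a support -/

/-- The rows are the eigenvectors scaled by the square roots of the nonzero eigenvalues. Having
exactly `K.rank` rows is what keeps the space of quadratic functionals small. -/
theorem exists_eq_transpose_mul_self {n : ℕ} {K : Matrix (Fin n) (Fin n) ℝ} (hK : K.PosSemidef) :
    ∃ B : Matrix (Fin K.rank) (Fin n) ℝ, K = Bᵀ * B := by
  obtain ⟨E⟩ := EigenSolver.nonempty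
  have hs : K.IsSymm := by simpa [IsSymm, IsHermitian] using hK.1
  let φ := Fintype.equivFinOfCardEq (E.rank_eq hs).symm
  refine ⟨of fun k i => √(E.vals K (φ.symm k)) * E.vecs K i (φ.symm k), ?_⟩
  conv_lhs => rw [E.eq_mul hs]
  ext i j
  simp only [mul_apply, transpose_apply, of_apply, diagonal_apply, mul_ite, mul_zero,
    Finset.sum_ite_eq', Finset.mem_univ, if_true]
  rw [φ.symm.sum_comp (fun k : {j // E.vals K j ≠ 0} => √(E.vals K k) * E.vecs K i k *
    (√(E.vals K k) * E.vecs K j k))]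
  symm
  refine Fintype.sum_of_injective _ Subtype.val_injective _ _ (fun k hk => ?_) fun k => ?_
  · have : E.vals K k = 0 := by
      by_contra h
      exact hk ⟨⟨k, h⟩, rfl⟩
    simp [this]
  · rw [show √(E.vals K k) * E.vecs K i k * (√(E.vals K k) * E.vecs K j k) =
      (√(E.vals K k) * √(E.vals K k)) * (E.vecs K i k * E.vecs K j k) by ring,
      Real.mul_self_sqrt (E.vals_nonneg hK k)]
    ring

/-- For every support there is a quadratic functional of the columns of the factor whose sum over
the support is the value of the support, and over any other support at most its value. -/
theorem exists_functional (E : EigenSolver) {m n s d : ℕ} {K : Matrix (Fin n) (Fin n) ℝ}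
    (B : Matrix (Fin m) (Fin n) ℝ) (hB : K = Bᵀ * B) (h : d ≤ s) (c : Fin s → Fin n) :
    ∃ Q : Fin m × Fin m → ℝ,
      ∑ l, ∑ x, Q x * (B x.1 (c l) * B x.2 (c l)) = supportValue E K h c ∧
      ∀ c' : Fin s → Fin n, ∑ l, ∑ x, Q x * (B x.1 (c' l) * B x.2 (c' l)) ≤
        supportValue E K h c' := by
  have hK : K.PosSemidef := by
    rw [hB, ← conjTranspose_eq_transpose_of_trivial]
    exact posSemidef_conjTranspose_mul_self B
  have hsub : ∀ c : Fin s → Fin n,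
      K.submatrix c c = (B.submatrix id c)ᵀ * B.submatrix id c := by
    intro c
    rw [hB]
    ext i j
    simp [mul_apply]
  have hsym : ∀ c : Fin s → Fin n, (K.submatrix c c).IsSymm := fun c => by
    simpa [IsSymm, IsHermitian] using (hK.submatrix c).1
  -- the normalized left singular vectors of the columns indexed by `c`
  let W : (Fin s → Fin n) → Matrix (Fin m) (Fin s) ℝ := fun c =>
    of fun a j => (B.submatrix id c * E.vecs (K.submatrix c c)) a j / √(E.vals (K.submatrix c c) j)
  have hgram : ∀ c : Fin s → Fin n, (B.submatrix id c * E.vecs (K.submatrix c c))ᵀ *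
      (B.submatrix id c * E.vecs (K.submatrix c c)) = diagonal (E.vals (K.submatrix c c)) := by
    intro c
    have h₁ := E.transpose_mul_mul (hsym c)
    conv_lhs at h₁ => rw [Matrix.mul_assoc]; arg 2; arg 1; rw [hsub c]
    rw [← h₁, transpose_mul]
    simp only [Matrix.mul_assoc]
  have hdiv : ∀ (c : Fin s → Fin n) j, (E.vals (K.submatrix c c) j) / √(E.vals (K.submatrix c c) j) =
      √(E.vals (K.submatrix c c) j) := fun c j => Real.div_sqrt
  -- Division by zero turns the columns with eigenvalue `0` into zero columns, and `√λ / √λ` is `1`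
  -- or `0` accordingly.
  have hW : ∀ c : Fin s → Fin n, (W c)ᵀ * W c = diagonal fun j =>
      √(E.vals (K.submatrix c c) j) / √(E.vals (K.submatrix c c) j) := by
    intro c
    ext i j
    have := congrFun (congrFun (hgram c) i) j
    rw [mul_apply] at this
    simp only [transpose_apply] at this
    simp only [W, mul_apply (M := (of _)ᵀ), transpose_apply, of_apply, div_mul_div_comm,
      ← Finset.sum_div]
    rw [this]
    by_cases hij : i = j
    · subst hij
      simp only [diagonal_apply_eq]
      rw [← div_div, hdiv]
    · simp [diagonal_apply_ne _ hij]
  have hε : ∀ (c : Fin s → Fin n) j, √(E.vals (K.submatrix c c) j) / √(E.vals (K.submatrix c c) j) ≤ 1 :=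
    fun c j => div_self_le_one _
  have hnorm : ∀ (c : Fin s → Fin n) j, ∑ a, ((B.submatrix id c * E.vecs (K.submatrix c c)) a j) ^ 2 =
      E.vals (K.submatrix c c) j := by
    intro c j
    have := congrFun (congrFun (hgram c) j) j
    rw [mul_apply] at this
    simpa [sq] using this
  -- For eigenvalue `0` the column on the right has squared norm `0`, so nothing is lost by the
  -- division.
  have hWB : ∀ (c : Fin s → Fin n) a j, √(E.vals (K.submatrix c c) j) * W c a j =
      (B.submatrix id c * E.vecs (K.submatrix c c)) a j := by
    intro c a j
    by_cases h0 : E.vals (K.submatrix c c) j = 0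
    · have h₁ := hnorm c j
      rw [h0, Finset.sum_eq_zero_iff_of_nonneg fun _ _ => sq_nonneg _] at h₁
      simp only [h0, Real.sqrt_zero, zero_mul]
      exact (pow_eq_zero_iff two_ne_zero |>.1 (h₁ a (Finset.mem_univ a))).symm
    · have : √(E.vals (K.submatrix c c) j) ≠ 0 :=
        (Real.sqrt_pos.2 (lt_of_le_of_ne (E.vals_nonneg (hK.submatrix c) j) (Ne.symm h0))).ne'
      simp only [W, of_apply]
      field_simp
  let V : Matrix (Fin m) (Fin d) ℝ := (W c).submatrix id (Fin.castLE h)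
  have hV : Vᵀ * V = diagonal fun j => √(E.vals (K.submatrix c c) (Fin.castLE h j)) /
      √(E.vals (K.submatrix c c) (Fin.castLE h j)) := by
    ext i j
    have := congrFun (congrFun (hW c) (Fin.castLE h i)) (Fin.castLE h j)
    simpa [V, mul_apply, diagonal_apply] using this
  have hquad : ∀ c' : Fin s → Fin n,
      ∑ l, ∑ x : Fin m × Fin m, (∑ k, V x.1 k * V x.2 k) * (B x.1 (c' l) * B x.2 (c' l)) =
      ∑ k, ∑ l, (∑ a, B a (c' l) * V a k) ^ 2 := by
    intro c'
    rw [Finset.sum_comm (γ := Fin d)]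
    refine Finset.sum_congr rfl fun l _ => ?_
    simp only [Finset.sum_mul, Fintype.sum_prod_type, sq, Finset.mul_sum]
    rw [Finset.sum_comm_cycle]
    refine Finset.sum_congr rfl fun k _ => ?_
    rw [Finset.sum_comm]
    refine Finset.sum_congr rfl fun a _ => Finset.sum_congr rfl fun b _ => by ring
  -- The functional is the quadratic form of `V Vᵀ`, the projection onto the leading left singular
  -- vectors with nonzero singular value.
  refine ⟨fun x => ∑ k, V x.1 k * V x.2 k, ?_, fun c' => ?_⟩
  · rw [hquad c, supportValue, topSum]
    refine Finset.sum_congr rfl fun k _ => ?_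
    set j := Fin.castLE h k
    -- The singular value relation: the transposed factor maps a left singular vector to `√λ` times
    -- the eigenvector.
    have h₁ : ∀ l, ∑ a, B a (c l) * V a k =
        E.vecs (K.submatrix c c) l j * √(E.vals (K.submatrix c c) j) := by
      intro l
      have h₂ := congrFun (congrFun (E.decomposition _ (hsym c)) l) j
      rw [mul_diagonal] at h₂
      conv_lhs at h₂ => arg 1; rw [hsub c]
      rw [Matrix.mul_assoc, mul_apply] at h₂
      simp only [transpose_apply, submatrix_apply, id] at h₂
      calc ∑ a, B a (c l) * V a k = (∑ a, B a (c l) *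
            (B.submatrix id c * E.vecs (K.submatrix c c)) a j) /
              √(E.vals (K.submatrix c c) j) := by
            rw [Finset.sum_div]
            exact Finset.sum_congr rfl fun a _ => by
              simp only [V, W, submatrix_apply, of_apply, id, mul_div_assoc, j]
        _ = _ := by rw [h₂, mul_div_assoc, hdiv]
    have h₃ := congrFun (congrFun (E.orthonormal_vecs _ (hsym c)) j) j
    rw [mul_apply, one_apply_eq] at h₃
    simp only [transpose_apply] at h₃
    simp only [h₁, mul_pow, Real.sq_sqrt (E.vals_nonneg (hK.submatrix c) j)]
    rw [← Finset.sum_mul]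
    simp only [sq, h₃, one_mul]
  · rw [hquad c']
    have h₁ := sum_mul_sq_le_topSum h (E.antitone_vals _ (hsym c')) (E.vals_nonneg (hK.submatrix c'))
      (hW c') (hε c') hV (fun j => hε c _)
    refine le_of_eq_of_le ?_ h₁
    simp only [Finset.mul_sum]
    refine Eq.trans (Finset.sum_congr rfl fun k _ => ?_) Finset.sum_comm
    -- both sides are the squared norm of a vector, up to the rotation by the eigenvectors
    let b : Fin s → ℝ := fun l => ∑ a, B a (c' l) * V a k
    have h₂ : ∀ j, E.vals (K.submatrix c' c') j * (∑ a, W c' a j * V a k) ^ 2 =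
        (b ᵥ* E.vecs (K.submatrix c' c')) j ^ 2 := by
      intro j
      rw [← Real.sq_sqrt (E.vals_nonneg (hK.submatrix c') j), ← mul_pow, Finset.mul_sum]
      simp only [← mul_assoc, hWB]
      congr 1
      simp only [vecMul, dotProduct, b, mul_apply, submatrix_apply, id, Finset.sum_mul]
      rw [Finset.sum_comm]
      exact Finset.sum_congr rfl fun a _ => Finset.sum_congr rfl fun l _ => by ring
    simp only [h₂]
    have h₃ : (b ᵥ* E.vecs (K.submatrix c' c')) ⬝ᵥ (b ᵥ* E.vecs (K.submatrix c' c')) = b ⬝ᵥ b := by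
      rw [← dotProduct_mulVec, ← mulVec_transpose, mulVec_mulVec, E.vecs_mul_transpose (hsym c'),
        one_mulVec]
    simpa [dotProduct, sq, b] using h₃.symm

/-! ### Sign patterns of functions in a finite-dimensional space -/

section signs

variable {ι : Type*} [Fintype ι]

/-- `f` has the sign pattern of `g` and is at least one in absolute value where it is nonzero. -/
def Dominates (f g : ι → ℝ) : Prop :=
  ∀ i, (0 < g i → 1 ≤ f i) ∧ (g i < 0 → f i ≤ -1) ∧ (g i = 0 → f i = 0)

/-- The coordinates in which `f` takes one of the values `-1`, `0`, `1`. -/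
def tight (f : ι → ℝ) : Set ι := {i | f i = 0 ∨ f i = 1 ∨ f i = -1}

/-- Scale `g` by the sum of the `1 / |g i|`; zero coordinates contribute `0` to this sum. -/
theorem exists_dominates (L : Submodule ℝ (ι → ℝ)) {g : ι → ℝ} (hg : g ∈ L) :
    ∃ f ∈ L, Dominates f g := by
  set C : ℝ := ∑ i, 1 / |g i|
  have hC : ∀ i, 1 / |g i| ≤ C := fun i =>
    Finset.single_le_sum (f := fun i => 1 / |g i|) (fun _ _ => by positivity) (Finset.mem_univ i)
  refine ⟨C • g, L.smul_mem _ hg, fun i => ⟨fun h => ?_, fun h => ?_, fun h => by simp [h]⟩⟩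
  · have := mul_le_mul_of_nonneg_right (hC i) h.le
    rwa [abs_of_pos h, one_div_mul_cancel h.ne'] at this
  · have := mul_le_mul_of_nonneg_right (hC i) (neg_pos.2 h).le
    rw [abs_of_neg h, one_div_mul_cancel (neg_pos.2 h).ne'] at this
    simp only [Pi.smul_apply, smul_eq_mul]
    linarith

/-- Moving along `u` until the next coordinate becomes tight. -/
theorem exists_dominates_tight_ssubset (L : Submodule ℝ (ι → ℝ)) {f g u : ι → ℝ} (hf : f ∈ L)
    (hfg : Dominates f g) (hu : u ∈ L) (hu0 : ∀ i ∈ tight f, u i = 0) {i₀ : ι}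
    (hi₀ : u i₀ * f i₀ < 0) : ∃ f' ∈ L, Dominates f' g ∧ tight f ⊂ tight f' := by
  classical
  have habs : ∀ i, f i ≠ 0 → 1 ≤ |f i| := by
    intro i hi
    rcases lt_trichotomy (g i) 0 with h | h | h
    · have := (hfg i).2.1 h
      rw [abs_of_neg (by linarith)]
      linarith
    · exact absurd ((hfg i).2.2 h) hi
    · exact ((hfg i).1 h).trans (le_abs_self _)
  -- Only coordinates that move towards zero can violate domination. The quotient is the time at
  -- which such a coordinate reaches absolute value one; the first to do so limits the step.
  obtain ⟨i₁, hi₁, hmin⟩ := Finset.exists_min_image (Finset.univ.filter fun i => u i * f i < 0)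
    (fun i => (|f i| - 1) / |u i|) ⟨i₀, by simpa using hi₀⟩
  simp only [Finset.mem_filter, Finset.mem_univ, true_and] at hi₁ hmin
  set τ := (|f i₁| - 1) / |u i₁|
  have hu₁ : u i₁ ≠ 0 := fun h => by simp [h] at hi₁
  have hf₁ : f i₁ ≠ 0 := fun h => by simp [h] at hi₁
  have hτ : 0 ≤ τ := div_nonneg (by linarith [habs i₁ hf₁]) (abs_nonneg _)
  have hτu : τ * |u i₁| = |f i₁| - 1 := div_mul_cancel₀ _ (abs_pos.2 hu₁).ne'
  have hstep : ∀ i, u i * f i < 0 → τ * |u i| ≤ |f i| - 1 := by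
    intro i hi
    have hui : 0 < |u i| := abs_pos.2 fun h => by simp [h] at hi
    exact (le_div_iff₀ hui).1 (hmin i hi)
  refine ⟨f + τ • u, L.add_mem hf (L.smul_mem _ hu), fun i => ⟨fun h => ?_, fun h => ?_,
    fun h => ?_⟩, ?_⟩
  · have h₁ := (hfg i).1 h
    simp only [Pi.add_apply, Pi.smul_apply, smul_eq_mul]
    rcases le_or_gt 0 (u i) with h₂ | h₂
    · nlinarith
    · have := hstep i (by nlinarith)
      rw [abs_of_neg h₂, abs_of_pos (by linarith)] at this
      linarith
  · have h₁ := (hfg i).2.1 h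
    simp only [Pi.add_apply, Pi.smul_apply, smul_eq_mul]
    rcases le_or_gt (u i) 0 with h₂ | h₂
    · nlinarith
    · have := hstep i (by nlinarith)
      rw [abs_of_pos h₂, abs_of_neg (by linarith)] at this
      linarith
  · have h₁ := (hfg i).2.2 h
    simp [h₁, hu0 i (Or.inl h₁)]
  · refine (Set.ssubset_iff_of_subset fun i hi => ?_).2 ⟨i₁, ?_, fun h => hu₁ (hu0 _ h)⟩
    · simpa [tight, hu0 i hi] using hi
    · simp only [tight, Set.mem_ofPred_eq, Pi.add_apply, Pi.smul_apply, smul_eq_mul]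
      rcases lt_or_gt_of_ne hu₁ with h | h
      · rw [abs_of_neg h, abs_of_pos (pos_of_mul_neg_right hi₁ h.le)] at hτu
        exact Or.inr (Or.inl (by linarith))
      · rw [abs_of_pos h, abs_of_neg (neg_of_mul_neg_right hi₁ h.le)] at hτu
        exact Or.inr (Or.inr (by linarith))

/-- Every sign pattern is attained at a vertex: by a function that is determined by the coordinates
in which it is `-1`, `0` or `1`. -/
theorem exists_vertex (L : Submodule ℝ (ι → ℝ)) {g : ι → ℝ} (hg : g ∈ L) :
    ∃ f ∈ L, Dominates f g ∧ ∀ u ∈ L, (∀ i ∈ tight f, u i = 0) → u = 0 := by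
  classical
  obtain ⟨f₀, hf₀, hd₀⟩ := exists_dominates L hg
  -- Take `f` with as many tight coordinates as possible. A nonzero `u` vanishing on all of them, or
  -- its negative, would move some coordinate towards zero and produce one more.
  let S : Set ℕ := {k | ∃ f ∈ L, Dominates f g ∧ (tight f).ncard = k}
  have hS : BddAbove S := ⟨Nat.card ι, by
    rintro _ ⟨f, -, -, rfl⟩
    exact Set.ncard_le_card _⟩
  obtain ⟨f, hf, hd, hcard⟩ := Nat.sSup_mem (s := S) ⟨_, f₀, hf₀, hd₀, rfl⟩ hS
  refine ⟨f, hf, hd, fun u hu hu0 => ?_⟩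
  by_contra hne
  obtain ⟨i, hi⟩ := Function.ne_iff.1 hne
  have hfi : f i ≠ 0 := fun h => hi (hu0 i (Or.inl h))
  obtain ⟨f', hf', hd', hss⟩ : ∃ f' ∈ L, Dominates f' g ∧ tight f ⊂ tight f' := by
    rcases lt_or_gt_of_ne (mul_ne_zero hi hfi) with h | h
    · exact exists_dominates_tight_ssubset L hf hd hu hu0 h
    · exact exists_dominates_tight_ssubset L hf hd (L.neg_mem hu)
        (fun i hi => by simp [hu0 i hi]) (i₀ := i) (by simpa using h)
  have h₁ := Set.ncard_lt_ncard hss (Set.toFinite _)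
  have h₂ := le_csSup hS ⟨f', hf', hd', rfl⟩
  omega

/-- A space of dimension at most `D` of functions that are determined by their values on `T` is
determined by the values at `D` points of `T`. -/
theorem exists_determining_tuple {T : Set ι} {e : ι} (he : e ∈ T) (D : ℕ) :
    ∀ L : Submodule ℝ (ι → ℝ), Module.finrank ℝ L ≤ D →
      (∀ u ∈ L, (∀ i ∈ T, u i = 0) → u = 0) →
      ∃ t : Fin D → ι, (∀ k, t k ∈ T) ∧ ∀ u ∈ L, (∀ k, u (t k) = 0) → u = 0 := by
  induction D with
  | zero =>
    intro L hL _
    have : L = ⊥ := Submodule.finrank_eq_zero.1 (by omega)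
    exact ⟨Fin.elim0, fun k => k.elim0, fun u hu _ => by simpa [this] using hu⟩
  | succ D ih =>
    intro L hL hT
    by_cases h0 : ∀ u ∈ L, u = 0
    -- The dimension may be smaller than the number of points; the remaining ones are filled with
    -- `e`.
    · exact ⟨fun _ => e, fun _ => he, fun u hu _ => h0 u hu⟩
    push Not at h0
    obtain ⟨v, hv, hv0⟩ := h0
    obtain ⟨i, hi, hvi⟩ : ∃ i ∈ T, v i ≠ 0 := by
      by_contra! h
      exact hv0 (hT v hv h)
    -- Fixing the value at `i`, where some member does not vanish, lowers the dimension.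
    let L' := L ⊓ (LinearMap.proj i : (ι → ℝ) →ₗ[ℝ] ℝ).ker
    have hlt : L' < L := by
      refine lt_of_le_of_ne inf_le_left fun h => hvi ?_
      have : v ∈ L' := h ▸ hv
      simpa using this.2
    obtain ⟨t, ht, htL⟩ := ih L' (by have := Submodule.finrank_lt_finrank_of_lt hlt; omega)
      fun u hu => hT u hu.1
    refine ⟨Fin.cons i t, fun k => ?_, fun u hu h => htL u ⟨hu, ?_⟩ fun k => ?_⟩
    · refine Fin.cases ?_ (fun k => ?_) k
      · simpa using hi
      · simpa using ht k
    · simpa using h 0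
    · simpa using h k.succ

end signs

/-! ### Interpolation through the pseudo-inverse of a Gram matrix -/

/-- The sum is `W Vᵀ M⁺ y`, where `V` has the rows of `W` at the points `t`, `M = V Vᵀ` and `y = V
Q`. As `y` lies in the range of `M`, the coefficient vector `Vᵀ M⁺ y` takes the same values as `Q`
at the points `t`, and by `hdet` these determine the function. `M` may be singular, since points may
repeat. -/
theorem eigenvalue_interpolation (E : EigenSolver) {ι κ : Type*} [Fintype κ] {D : ℕ}
    (W : Matrix ι κ ℝ) (t : Fin D → ι) (Q : κ → ℝ)
    (hdet : ∀ Q' : κ → ℝ, (∀ k, (W *ᵥ Q') (t k) = 0) → W *ᵥ Q' = 0) (i : ι) :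
    let M : Matrix (Fin D) (Fin D) ℝ := (W * Wᵀ).submatrix t t
    ∑ j, ∑ k, ∑ l, E.vecs M k j * (W * Wᵀ) (t k) i * (E.vecs M l j * (W *ᵥ Q) (t l)) /
      E.vals M j = (W *ᵥ Q) i := by
  intro M
  set U := E.vecs M
  set w := E.vals M
  have hMs : M.IsSymm := by
    ext i j
    simp [M, mul_apply, mul_comm]
  let V : Matrix (Fin D) κ ℝ := W.submatrix t id
  have hM : M = V * Vᵀ := by
    ext i j
    simp [M, V, mul_apply]
  set y : Fin D → ℝ := V *ᵥ Q with hy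
  have hyt : ∀ l, (W *ᵥ Q) (t l) = y l := fun l => rfl
  -- These are the coordinates of `M⁺ y` in the eigenbasis: division by a zero eigenvalue gives `0`,
  -- as the pseudo-inverse requires.
  let β : Fin D → ℝ := fun j => (y ᵥ* U) j / w j
  have hβ : ∀ j, w j * β j = (y ᵥ* U) j := by
    intro j
    by_cases h0 : w j = 0
    · -- `y` is orthogonal to the kernel of the Gram matrix
      have h₁ : M *ᵥ (fun k => U k j) = 0 := by
        ext k
        have := congrFun (congrFun (E.decomposition M hMs) k) j
        rw [mul_diagonal, mul_apply] at this
        simpa [mulVec, dotProduct, U, show E.vals M j = 0 from h0] using this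
      have h₂ : Vᵀ *ᵥ (fun k => U k j) = 0 := by
        rw [← dotProduct_self_eq_zero, dotProduct_mulVec, ← mulVec_transpose, transpose_transpose,
          mulVec_mulVec, ← hM, h₁, zero_dotProduct]
      have h₃ : (y ᵥ* U) j = 0 := by
        change y ⬝ᵥ (fun k => U k j) = 0
        rw [hy, dotProduct_comm, dotProduct_mulVec, ← mulVec_transpose, h₂, zero_dotProduct]
      rw [h0, h₃, zero_mul]
    · exact mul_div_cancel₀ _ h0
  let α : Fin D → ℝ := U *ᵥ β
  have hα : M *ᵥ α = y := by
    have h₁ : M *ᵥ α = U *ᵥ (fun j => w j * β j) := by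
      simp only [α, mulVec_mulVec]
      rw [E.decomposition M hMs, ← mulVec_mulVec]
      congr 1
      ext j
      rw [mulVec_diagonal]
    have h₂ : (fun j => w j * β j) = Uᵀ *ᵥ y := by
      ext j
      rw [hβ, mulVec_transpose]
    rw [h₁, h₂, mulVec_mulVec, E.vecs_mul_transpose hMs, one_mulVec]
  have hkey := hdet (Vᵀ *ᵥ α - Q) fun k => by
    have : (V *ᵥ (Vᵀ *ᵥ α)) k = y k := by rw [mulVec_mulVec, ← hM, hα]
    rw [mulVec_sub, Pi.sub_apply]
    exact sub_eq_zero.2 this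
  rw [mulVec_sub, sub_eq_zero, mulVec_mulVec] at hkey
  simp only [hyt]
  refine Eq.trans ?_ (congrFun hkey i)
  simp only [mulVec, dotProduct, α, β, vecMul, Finset.mul_sum, Finset.sum_div]
  rw [Finset.sum_comm]
  refine Finset.sum_congr rfl fun k _ => Finset.sum_congr rfl fun j _ =>
    Finset.sum_congr rfl fun l _ => ?_
  have h₁ : (W * Vᵀ) i k = (W * Wᵀ) (t k) i := by
    simp [V, mul_apply, mul_comm]
  rw [h₁]
  ring

/-! ### Selecting the largest entries -/

/-- The indices outside the range of `c` have no larger sign than those in the range. -/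
def SelectsSigns {n s : ℕ} (key : Fin n → ℝ) (c : Fin s → Fin n) : Prop :=
  ∀ i ∉ Set.range c, ∀ l, (0 < key i → 0 < key (c l)) ∧ (0 ≤ key i → 0 ≤ key (c l))

/-- Some value is an `s`-th largest one. -/
theorem exists_threshold {n s : ℕ} (hs : 0 < s) (hsn : s ≤ n) (q : Fin n → ℝ) :
    ∃ e, (Finset.univ.filter fun i => q e < q i).card < s ∧
      s ≤ (Finset.univ.filter fun i => q e ≤ q i).card := by
  classical
  have hne : (Finset.univ.filter fun e => s ≤
      (Finset.univ.filter fun i => q e ≤ q i).card).Nonempty := by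
    have : Nonempty (Fin n) := ⟨⟨0, by omega⟩⟩
    obtain ⟨e, he⟩ := Finite.exists_min q
    exact ⟨e, by simp [he, hsn]⟩
  obtain ⟨e, he, hmax⟩ := Finset.exists_max_image _ q hne
  simp only [Finset.mem_filter, Finset.mem_univ, true_and] at he hmax
  refine ⟨e, ?_, he⟩
  by_contra! h
  -- If `s` values exceeded `q e`, the smallest of them would contradict the maximality of `q e`.
  obtain ⟨e', he', hmin⟩ := Finset.exists_min_image (Finset.univ.filter fun i => q e < q i) q
    (Finset.card_pos.1 (by omega))
  simp only [Finset.mem_filter, Finset.mem_univ, true_and] at he' hmin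
  have := hmax e' (h.trans (Finset.card_le_card fun i hi => ?_))
  · linarith
  · simp only [Finset.mem_filter, Finset.mem_univ, true_and] at hi ⊢
    exact hmin i hi

/-- A selection by the signs of `q - q e` maximizes the sum of `q`. -/
theorem sum_le_of_selectsSigns {n s : ℕ} {q key : Fin n → ℝ} {e : Fin n}
    (he₁ : (Finset.univ.filter fun i => q e < q i).card < s)
    (he₂ : s ≤ (Finset.univ.filter fun i => q e ≤ q i).card)
    (hpos : ∀ i, 0 < key i ↔ q e < q i) (hnonneg : ∀ i, 0 ≤ key i ↔ q e ≤ q i)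
    {c c' : Fin s → Fin n} (hc : c.Injective) (hc' : c'.Injective) (h : SelectsSigns key c) :
    ∑ l, q (c' l) ≤ ∑ l, q (c l) := by
  classical
  have hcard : (Finset.univ.image c).card = s := by
    rw [Finset.card_image_of_injective _ hc, Finset.card_univ, Fintype.card_fin]
  have h₁ : ∀ i, q e < q i → i ∈ Set.range c := by
    intro i hi
    by_contra hic
    have hsub : Finset.univ.image c ⊆ Finset.univ.filter fun i => q e < q i := by
      intro j hj
      obtain ⟨l, -, rfl⟩ := Finset.mem_image.1 hj
      simpa using (hpos _).1 ((h i hic l).1 ((hpos i).2 hi))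
    have := Finset.card_le_card hsub
    omega
  have h₂ : ∀ l, q e ≤ q (c l) := by
    intro l
    by_contra hl
    have hsub : (Finset.univ.filter fun i => q e ≤ q i) ⊆ (Finset.univ.image c).erase (c l) := by
      intro i hi
      simp only [Finset.mem_filter, Finset.mem_univ, true_and] at hi
      refine Finset.mem_erase.2 ⟨fun h => hl (h ▸ hi), ?_⟩
      by_contra hic
      refine hl ((hnonneg _).1 ((h i (fun ⟨l', hl'⟩ => hic ?_) l).2 ((hnonneg i).2 hi)))
      exact Finset.mem_image.2 ⟨l', Finset.mem_univ _, hl'⟩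
    have := (Finset.card_le_card hsub).trans_lt
      (Finset.card_erase_lt_of_mem (Finset.mem_image_of_mem c (Finset.mem_univ l)))
    omega
  -- The sum of all positive parts of `q - q e` bounds every selection, and `c` attains it: by `h₁`
  -- it misses no positive term, by `h₂` it contains no negative one.
  have h₃ : ∑ l, (q (c' l) - q e) ≤ ∑ l, (q (c l) - q e) := by
    calc ∑ l, (q (c' l) - q e) ≤ ∑ l, max (q (c' l) - q e) 0 :=
          Finset.sum_le_sum fun l _ => le_max_left _ _
      _ = ∑ i ∈ Finset.univ.image c', max (q i - q e) 0 :=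
          (Finset.sum_image (f := fun i => max (q i - q e) 0) fun _ _ _ _ h => hc' h).symm
      _ ≤ ∑ i, max (q i - q e) 0 :=
          Finset.sum_le_sum_of_subset_of_nonneg (Finset.subset_univ _)
            fun _ _ _ => le_max_right _ _
      _ = ∑ i ∈ Finset.univ.image c, max (q i - q e) 0 := by
          refine (Finset.sum_subset (Finset.subset_univ _) fun i _ hi => ?_).symm
          refine max_eq_right (sub_nonpos.2 (le_of_not_gt fun hlt => hi ?_))
          obtain ⟨l, rfl⟩ := h₁ i hlt
          exact Finset.mem_image_of_mem c (Finset.mem_univ l)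
      _ = ∑ l, max (q (c l) - q e) 0 :=
          Finset.sum_image (f := fun i => max (q i - q e) 0) fun _ _ _ _ h => hc h
      _ = ∑ l, (q (c l) - q e) :=
          Finset.sum_congr rfl fun l _ => max_eq_left (sub_nonneg.2 (h₂ l))
  simpa [Finset.sum_sub_distrib] using h₃

/-! ### The candidate functionals -/

/-- The inner product of the differences `cᵢ - cₑ` and `cⱼ - cₑ`, where `cᵢ` is the tensor square of
column `i` of a factor of `K`. -/
def centeredGram {n : ℕ} (K : Matrix (Fin n) (Fin n) ℝ) (e i j : Fin n) : ℝ :=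
  K i j * K i j - K i e * K i e - K e j * K e j + K e e * K e e

/-- The interpolating functional with values `y` at the points `t`, as the program computes it. -/
noncomputable def candidateKey (E : EigenSolver) {n D : ℕ} (K : Matrix (Fin n) (Fin n) ℝ)
    (e : Fin n) (t : Fin D → Fin n) (y : Fin D → ℝ) (i : Fin n) : ℝ :=
  let M : Matrix (Fin D) (Fin D) ℝ := of fun k l => centeredGram K e (t k) (t l)
  ∑ j, ∑ k, ∑ l, E.vecs M k j * centeredGram K e (t k) i * (E.vecs M l j * y l) / E.vals M j

/-- This is the completeness of the enumeration. The vertex `f` has the signs of `q - q e` for a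
functional `q` exposing an optimal support, and interpolation gives back `f` itself. Quantifying
over all selections `c` makes tie-breaking irrelevant. In rank `0` the pivot is pinned to `0`, since
only one pivot is tried. -/
theorem exists_maximal_candidate (E : EigenSolver) {n s d : ℕ} {K : Matrix (Fin n) (Fin n) ℝ}
    (hK : K.PosSemidef) (hs : 0 < s) (hsn : s ≤ n) (h : d ≤ s) {D : ℕ}
    (hD : D = (K.rank + 1).choose 2) :
    ∃ (e : Fin n) (t : Fin D → Fin n) (y : Fin D → ℝ), (K.rank = 0 → (e : ℕ) = 0) ∧
      (∀ k, y k = 0 ∨ y k = 1 ∨ y k = -1) ∧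
      ∀ c : Fin s → Fin n, c.Injective → SelectsSigns (candidateKey E K e t y) c →
        ∀ c' : Fin s → Fin n, c'.Injective → supportValue E K h c' ≤ supportValue E K h c := by
  classical
  obtain ⟨B, hB⟩ := exists_eq_transpose_mul_self hK
  -- a support of maximal value, and a functional that exposes it
  obtain ⟨c₀, hc₀, hmax⟩ : ∃ c₀ : Fin s → Fin n, c₀.Injective ∧ ∀ c' : Fin s → Fin n,
      c'.Injective → supportValue E K h c' ≤ supportValue E K h c₀ := by
    obtain ⟨c₀, hc₀, hmax⟩ := Finset.exists_max_image
      (Finset.univ.filter fun c : Fin s → Fin n => c.Injective) (supportValue E K h)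
      ⟨Fin.castLE hsn, by simpa using Fin.castLE_injective hsn⟩
    simp only [Finset.mem_filter, Finset.mem_univ, true_and] at hc₀ hmax
    exact ⟨c₀, hc₀, hmax⟩
  obtain ⟨Q, hQ₁, hQ₂⟩ := exists_functional E B hB h c₀
  set q : Fin n → ℝ := fun i => ∑ x, Q x * (B x.1 i * B x.2 i) with hq
  obtain ⟨e, he0, he₁, he₂⟩ : ∃ e : Fin n, (K.rank = 0 → (e : ℕ) = 0) ∧
      (Finset.univ.filter fun i => q e < q i).card < s ∧
      s ≤ (Finset.univ.filter fun i => q e ≤ q i).card := by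
    by_cases hr : K.rank = 0
    · have : IsEmpty (Fin K.rank × Fin K.rank) := by
        rw [hr]
        infer_instance
      have hq0 : ∀ i, q i = 0 := fun i => by simp [hq]
      exact ⟨⟨0, by omega⟩, fun _ => rfl, by simp [hq0, hs], by simp [hq0, hsn]⟩
    · obtain ⟨e, he⟩ := exists_threshold hs hsn q
      exact ⟨e, fun h => absurd h hr, he⟩
  let W : Matrix (Fin n) (Fin K.rank × Fin K.rank) ℝ :=
    of fun i x => B x.1 i * B x.2 i - B x.1 e * B x.2 e
  have hgram : ∀ i j, (W * Wᵀ) i j = centeredGram K e i j := by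
    have hsq : ∀ i j, K i j * K i j = ∑ x : Fin K.rank × Fin K.rank,
        (B x.1 i * B x.2 i) * (B x.1 j * B x.2 j) := by
      intro i j
      have : K i j = ∑ a, B a i * B a j := by
        conv_lhs => rw [hB]
        simp [mul_apply]
      rw [this, Finset.sum_mul_sum, Fintype.sum_prod_type]
      exact Finset.sum_congr rfl fun a _ => Finset.sum_congr rfl fun b _ => by ring
    intro i j
    simp only [centeredGram, hsq, ← Finset.sum_sub_distrib, ← Finset.sum_add_distrib, mul_apply,
      transpose_apply, W, of_apply]
    exact Finset.sum_congr rfl fun x _ => by ring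
  let L : Submodule ℝ (Fin n → ℝ) := LinearMap.range W.mulVecLin
  have hL : Module.finrank ℝ L ≤ D := by
    -- The columns `(a, b)` and `(b, a)` of `W` agree, so unordered pairs index a spanning set; this
    -- gives `r (r + 1) / 2` in place of `r ^ 2`.
    let φ : Sym2 (Fin K.rank) → Fin n → ℝ := Sym2.lift
      ⟨fun a b => W.col (a, b), fun a b => by ext i; simp [W, mul_comm]⟩
    have hcol : Set.range W.col ⊆ Set.range φ := by
      rintro _ ⟨⟨a, b⟩, rfl⟩
      exact ⟨s(a, b), rfl⟩
    calc Module.finrank ℝ L = Module.finrank ℝ (Submodule.span ℝ (Set.range W.col)) := by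
          rw [show L = _ from range_mulVecLin W]
      _ ≤ Module.finrank ℝ (Submodule.span ℝ (Set.range φ)) :=
          Submodule.finrank_mono (Submodule.span_mono hcol)
      _ ≤ Fintype.card (Sym2 (Fin K.rank)) := finrank_range_le_card φ
      _ = D := by rw [Sym2.card, Fintype.card_fin, hD]
  have hg : ∀ i, (W *ᵥ Q) i = q i - q e := by
    intro i
    simp only [mulVec, dotProduct, W, of_apply, hq, ← Finset.sum_sub_distrib]
    exact Finset.sum_congr rfl fun x _ => by ring
  obtain ⟨f, ⟨Q', hQ'⟩, hdom, hdet⟩ := exists_vertex L (g := W *ᵥ Q) ⟨Q, rfl⟩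
  -- The pivot is always tight, so it can serve as a filler point.
  have hee : e ∈ tight f := Or.inl ((hdom e).2.2 (by rw [hg, sub_self]))
  obtain ⟨t, ht, htL⟩ := exists_determining_tuple hee D L hL hdet
  refine ⟨e, t, fun k => f (t k), he0, ht, fun c hc hsel c' hc' => ?_⟩
  have hkey : candidateKey E K e t (fun k => f (t k)) = f := by
    ext i
    have := eigenvalue_interpolation E W t Q' (fun Q'' hQ'' => htL _ ⟨Q'', rfl⟩ hQ'') i
    have hM : (W * Wᵀ).submatrix t t = of fun k l => centeredGram K e (t k) (t l) := by
      ext k l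
      simp [hgram]
    have hf : W *ᵥ Q' = f := hQ'
    simp only [hM, hgram, hf] at this
    exact this
  rw [hkey] at hsel
  have hpos : ∀ i, 0 < f i ↔ q e < q i := by
    intro i
    have := hdom i
    rw [hg] at this
    rcases lt_trichotomy (q i - q e) 0 with h | h | h
    · exact ⟨fun h' => by linarith [this.2.1 h], fun h' => by linarith⟩
    · exact ⟨fun h' => by linarith [this.2.2 h], fun h' => by linarith⟩
    · exact ⟨fun h' => by linarith, fun h' => by linarith [this.1 h]⟩
  have hnonneg : ∀ i, 0 ≤ f i ↔ q e ≤ q i := by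
    intro i
    have := hdom i
    rw [hg] at this
    rcases lt_trichotomy (q i - q e) 0 with h | h | h
    · exact ⟨fun h' => by linarith [this.2.1 h], fun h' => by linarith⟩
    · exact ⟨fun h' => by linarith, fun h' => by linarith [this.2.2 h]⟩
    · exact ⟨fun h' => by linarith, fun h' => by linarith [this.1 h]⟩
  calc supportValue E K h c' ≤ supportValue E K h c₀ := hmax c' hc'
    _ = ∑ l, q (c₀ l) := hQ₁.symm
    _ ≤ ∑ l, q (c l) := sum_le_of_selectsSigns he₁ he₂ hpos hnonneg hc hc₀ hsel
    _ ≤ supportValue E K h c := hQ₂ c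

/-! ### The program

Variables: `0` to `2` hold `n`, `d`, `s`; `3` the number of candidates so far; `4` the rank `r`;
`5` the number `D = r (r + 1) / 2` of interpolation points; `6` the number of pivots; `7` the base
`3 n` of the enumeration; `8` the number of the best candidate; `9` the size of the support under
construction; `10` to `13` are loop counters; `14` is a carry.

Arrays of naturals: `0` holds the candidates, `1` the digits of the current number (the last one is
the pivot), `2` the interpolation points.

Arrays of reals: `0` and `1` hold `K` and the solution; `2` and `3` eigenvalues and eigenvectors;
`4` the matrix to be decomposed; `5` the keys; `6` the accumulator; `7` the interpolation values;
`8` the best value. -/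

/-- The number of pivots to be tried. -/
def pivotCount (n r : ℕ) : ℕ := if r = 0 then 1 else n

/-- Compute the rank and the parameters of the enumeration. -/
def initProg : Prog :=
  .eig (.var 0) 0 2 3 ;;
  .for 10 0 (.ite (.rle (.get 2 (.var 10) (.const 0)) (.const 0)) .skip
    (.setVar 4 (.add (.var 4) (.const 1)) ;; .setVar 5 (.add (.var 5) (.var 4)))) ;;
  .ite (.nle (.var 4) (.const 0)) (.setVar 6 (.const 1)) (.setVar 6 (.var 0)) ;;
  .setVar 7 (.add (.add (.var 0) (.var 0)) (.var 0)) ;;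
  .setReal 8 (.const 0) (.const 0) (.const (-1))

/-- The digit whose number is in the variable `k`. -/
def digitExp (k : ℕ) : NExp := .get 1 (.var k) (.const 0)

/-- The interpolation point whose number is in the variable `k`. -/
def pointExp (k : ℕ) : NExp := .get 2 (.var k) (.const 0)

/-- Split each digit into an interpolation point and a value. -/
def decodeProg : Prog :=
  .for 10 5 (.ite (.nle (.var 0) (digitExp 10))
    (.ite (.nle (.add (.var 0) (.var 0)) (digitExp 10))
      (.setNat 2 (.var 10) (.const 0) (.sub (digitExp 10) (.add (.var 0) (.var 0))) ;;
        .setReal 7 (.var 10) (.const 0) (.const (-1)))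
      (.setNat 2 (.var 10) (.const 0) (.sub (digitExp 10) (.var 0)) ;;
        .setReal 7 (.var 10) (.const 0) (.const 1)))
    (.setNat 2 (.var 10) (.const 0) (digitExp 10) ;;
      .setReal 7 (.var 10) (.const 0) (.const 0)))

/-- The square of an entry of `K`. -/
def squareExp (i j : NExp) : RExp := .mul (.get 0 i j) (.get 0 i j)

/-- The centered Gram matrix, with the last digit as the pivot. -/
def gramExp (i j : NExp) : RExp :=
  .add (.sub (.sub (squareExp i j) (squareExp i (digitExp 5))) (squareExp (digitExp 5) j))
    (squareExp (digitExp 5) (digitExp 5))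

/-- Add up the terms of the interpolating functional at the index in variable `10`. -/
def keySumProg : Prog :=
  .for 11 5 (.for 12 5 (.for 13 5 (.accum
    (.div (.mul (.mul (.get 3 (.var 12) (.var 11)) (gramExp (pointExp 12) (.var 10)))
      (.mul (.get 3 (.var 13) (.var 11)) (.get 7 (.var 13) (.const 0))))
      (.get 2 (.var 11) (.const 0))))))

/-- Evaluate the interpolating functional at all indices. -/
def keysProg : Prog :=
  .fill 4 5 (gramExp (pointExp 10) (pointExp 11)) ;;
  .eig (.var 5) 4 2 3 ;;
  .for 10 0 (.zeroAcc ;; keySumProg ;;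
    .setReal 5 (.var 10) (.const 0) (.get 6 (.const 0) (.const 0)))

/-- Append the indices that pass a test to the current candidate, as long as there is room. -/
def passProg (b : Test) : Prog :=
  .for 10 0 (.ite (.and b (.not (.nle (.var 2) (.var 9))))
    (.setNat 0 (.var 3) (.var 9) (.var 10) ;; .setVar 9 (.add (.var 9) (.const 1))) .skip)

/-- The key of the index in variable `10` is at most zero. -/
def keyLe : Test := .rle (.get 5 (.var 10) (.const 0)) (.const 0)

/-- The key of the index in variable `10` is at least zero. -/
def keyGe : Test := .rle (.const 0) (.get 5 (.var 10) (.const 0))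

/-- Select `s` indices by the signs of their keys. -/
def selectProg : Prog :=
  .setVar 9 (.const 0) ;; passProg (.not keyLe) ;; passProg (.and keyLe keyGe) ;;
    passProg (.not keyGe)

/-- Decompose the principal submatrix on the candidate whose number is in the variable `row`. -/
def submatrixProg (row : ℕ) : Prog :=
  .fill 4 2 (.get 0 (.get 0 (.var row) (.var 10)) (.get 0 (.var row) (.var 11))) ;;
  .eig (.var 2) 4 2 3

/-- Compute the value of the current candidate. -/
def valueProg : Prog :=
  .zeroAcc ;;
  .ite (.nle (.var 4) (.var 1))
    (.for 10 2 (.accum (.get 0 (.get 0 (.var 3) (.var 10)) (.get 0 (.var 3) (.var 10)))))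
    (submatrixProg 3 ;; .for 10 1 (.accum (.get 2 (.var 10) (.const 0))))

/-- Compare the current candidate with the best one. -/
def bestProg : Prog :=
  .ite (.rle (.get 6 (.const 0) (.const 0)) (.get 8 (.const 0) (.const 0))) .skip
    (.setReal 8 (.const 0) (.const 0) (.get 6 (.const 0) (.const 0)) ;; .setVar 8 (.var 3))

/-- Proceed to the next number. -/
def nextProg : Prog :=
  .setVar 14 (.const 1) ;;
  .for 10 5 (.ite (.nle (.var 7) (.add (digitExp 10) (.var 14)))
    (.setNat 1 (.var 10) (.const 0) (.const 0))
    (.setNat 1 (.var 10) (.const 0) (.add (digitExp 10) (.var 14)) ;; .setVar 14 (.const 0))) ;;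
  .setNat 1 (.var 5) (.const 0) (.add (digitExp 5) (.var 14)) ;;
  .setVar 3 (.add (.var 3) (.const 1))

/-- Treat one candidate. -/
def candidateProg : Prog :=
  decodeProg ;; keysProg ;; selectProg ;; valueProg ;; bestProg ;; nextProg

/-- Write the eigenvectors to the rows in the best candidate. -/
def outputProg : Prog :=
  submatrixProg 8 ;;
  .for 10 2 (.for 11 1 (.setReal 1 (.get 0 (.var 8) (.var 10)) (.var 11)
    (.get 3 (.var 10) (.var 11))))

/-- The whole program. -/
def mainProg : Prog :=
  initProg ;; .loop (.not (.nle (.var 6) (digitExp 5))) candidateProg ;; outputProg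

/-! ### Correctness of the parts -/

/-- The data that stays fixed after the initialization. -/
structure Ctx {n : ℕ} (d s : ℕ) (K : Matrix (Fin n) (Fin n) ℝ) (τ : State) : Prop where
  var_n : τ.var 0 = n
  var_d : τ.var 1 = d
  var_s : τ.var 2 = s
  rank : τ.var 4 = K.rank
  dim : τ.var 5 = (K.rank + 1).choose 2
  pivots : τ.var 6 = pivotCount n K.rank
  base : τ.var 7 = 3 * n
  mat : ∀ i j : Fin n, τ.real 0 i j = K i j

section

variable {E : EigenSolver} {n d s : ℕ} {K : Matrix (Fin n) (Fin n) ℝ} {σ τ : State} {p : Prog}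

theorem Ctx.frame (hC : Ctx d s K σ) (hF : Frame p σ τ)
    (hv : ∀ v ∈ [0, 1, 2, 4, 5, 6, 7], v ∉ p.vars) (hr : 0 ∉ p.reals) : Ctx d s K τ where
  var_n := by rw [hF.var 0 (hv 0 (by simp)), hC.var_n]
  var_d := by rw [hF.var 1 (hv 1 (by simp)), hC.var_d]
  var_s := by rw [hF.var 2 (hv 2 (by simp)), hC.var_s]
  rank := by rw [hF.var 4 (hv 4 (by simp)), hC.rank]
  dim := by rw [hF.var 5 (hv 5 (by simp)), hC.dim]
  pivots := by rw [hF.var 6 (hv 6 (by simp)), hC.pivots]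
  base := by rw [hF.var 7 (hv 7 (by simp)), hC.base]
  mat i j := by rw [hF.real 0 hr, hC.mat]


/-- The program counts eigenvalues that are not `≤ 0`; by semidefiniteness these are the nonzero
ones. -/
theorem sum_vals_ne_zero (hK : K.PosSemidef) :
    ∑ k ∈ Finset.range n, (if h : k < n then (if E.vals K ⟨k, h⟩ ≤ 0 then 0 else 1) else 0) =
      K.rank := by
  have hs : K.IsSymm := by simpa [IsSymm, IsHermitian] using hK.1
  rw [Finset.sum_range, E.rank_eq hs, Fintype.card_subtype, Finset.card_filter]
  refine Finset.sum_congr rfl fun j _ => ?_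
  by_cases h : E.vals K j = 0
  · simp [h]
  · simp [h, lt_of_le_of_ne (E.vals_nonneg hK j) (Ne.symm h)]

theorem runs_initProg (hK : K.PosSemidef) :
    Runs E initProg (inputState d s K) (n ^ 3 + 1000 * (n + 1)) (fun τ => Ctx d s K τ ∧
      τ.real 8 0 0 = -1) := by
  let w : ℕ → ℕ := fun k => if h : k < n then (if E.vals K ⟨k, h⟩ ≤ 0 then 0 else 1) else 0
  have hw : ∑ k ∈ Finset.range n, w k = K.rank := sum_vals_ne_zero hK
  refine Runs.le (.seq (T₁ := 1 + 1 + n ^ 3) (T₂ := 1 + 20 * (n + 1) * 20 + (1 + 8 + (1 + 6 + 4)))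
    ?_) (by ring_nf; omega)
  refine (Runs.eig' (N := n) K (by simp [NExp.eval, inputState]) (by decide)
    (by simp [inputState])).mono le_rfl fun σ₁ hF₁ ⟨hvals, _⟩ => .seq ?_
  have hv : ∀ v, σ₁.var v = (inputState d s K).var v := fun v => hF₁.var v (by simp [Prog.vars])
  refine (Runs.for (N := n) (T := 20) (fun k τ => τ.var 4 = ∑ j ∈ Finset.range k, w j ∧
    τ.var 5 = (τ.var 4 + 1).choose 2) (by simp [hv, inputState]) (by decide) (by decide)
    (by norm_num) (fun k τ x h => by simpa using h) (by simp [hv, inputState]) ?_).mono le_rfl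
    fun σ₂ hF₂ ⟨h4, h5⟩ => .seq (Runs.mono (Q := fun τ => τ.var 6 = pivotCount n K.rank)
    (.ite (T₁ := 2) (T₂ := 2) (fun hb => .setVar ?_) fun hb => .setVar ?_) le_rfl
    fun σ₃ hF₃ h6 => .seq (.setVar (.setReal ?_)))
  · rintro k hk τ hF h10 ⟨h4, h5⟩
    have hval : τ.real 2 k 0 = E.vals K ⟨k, hk⟩ := by
      rw [hF.real 2 (by decide)]
      exact hvals ⟨k, hk⟩
    refine Runs.le (T := 1 + 5 + 1 + (1 + 4 + 4)) (.ite (fun hb => .skip ?_) fun hb => ?_)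
      (by norm_num)
    · have hb' : E.vals K ⟨k, hk⟩ ≤ 0 := by
        simpa [Test.holds, RExp.eval, NExp.eval, h10, hval] using hb
      rw [Finset.sum_range_succ]
      exact ⟨by simp [w, hk, hb', h4], h5⟩
    · have hb' : ¬ E.vals K ⟨k, hk⟩ ≤ 0 := by
        simpa [Test.holds, RExp.eval, NExp.eval, h10, hval] using hb
      refine .seq (.setVar (.setVar ?_))
      rw [Finset.sum_range_succ]
      refine ⟨by simp [NExp.eval, w, hk, hb', h4], ?_⟩
      -- Adding the updated rank each time it grows builds the triangular number without a
      -- multiplication, which naturals lack.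
      have : (τ.var 4 + 1 + 1).choose 2 = (τ.var 4 + 1).choose 2 + (τ.var 4 + 1) := by
        rw [Nat.choose_succ_succ' (τ.var 4 + 1) 1, Nat.choose_one_right, add_comm]
      simp [NExp.eval, h5, this]
  · have hr : σ₂.var 4 = K.rank := by rw [h4, hw]
    have : K.rank = 0 := by simpa [Test.holds, NExp.eval, hr] using hb
    simp [pivotCount, this, NExp.eval]
  · have hr : σ₂.var 4 = K.rank := by rw [h4, hw]
    have h0 : σ₂.var 0 = n := by rw [hF₂.var 0 (by decide), hv]; rfl
    have : K.rank ≠ 0 := by simpa [Test.holds, NExp.eval, hr] using hb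
    simp [pivotCount, this, NExp.eval, h0]
  · have hin : ∀ v ∈ [0, 1, 2], σ₃.var v = (inputState d s K).var v := by
      intro v hmem
      rw [hF₃.var v (by revert v; decide), hF₂.var v (by revert v; decide), hv]
    have h0 := hin 0 (by decide)
    have hmat : ∀ i j, σ₃.real 0 i j = (inputState d s K).real 0 i j := by
      intro i j
      rw [hF₃.real 0 (by decide), hF₂.real 0 (by decide), hF₁.real 0 (by decide)]
    have h4' : σ₃.var 4 = K.rank := by rw [hF₃.var 4 (by decide), h4, hw]
    have h5' : σ₃.var 5 = (K.rank + 1).choose 2 := by rw [hF₃.var 5 (by decide), h5, h4, hw]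
    refine ⟨⟨?_, ?_, ?_, ?_, ?_, ?_, ?_, fun i j => ?_⟩, ?_⟩
    · simpa [inputState] using h0
    · simpa [inputState] using hin 1 (by decide)
    · simpa [inputState] using hin 2 (by decide)
    · simpa using h4'
    · simpa using h5'
    · simpa using h6
    · have h0' : σ₃.var 0 = n := h0
      simp [NExp.eval, h0']
      ring
    · simp [put, hmat, inputState]
    · simp [put, NExp.eval, RExp.eval]

/-- The interpolation point in a digit. -/
def digitPoint (n z : ℕ) : ℕ := if n ≤ z then (if n + n ≤ z then z - (n + n) else z - n) else z

/-- The interpolation value in a digit. -/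
def digitValue (n z : ℕ) : ℝ := if n ≤ z then (if n + n ≤ z then -1 else 1) else 0

/-- A digit below `3 n` lies in one of three blocks of length `n`: the block encodes the value `0`,
`1` or `-1`, the offset in it the point. -/
theorem runs_decodeProg (hC : Ctx d s K σ) :
    Runs E decodeProg σ (2000 * ((K.rank + 1).choose 2 + 1)) (fun τ =>
      ∀ k < (K.rank + 1).choose 2, τ.nat 2 k 0 = digitPoint n (σ.nat 1 k 0) ∧
        τ.real 7 k 0 = digitValue n (σ.nat 1 k 0)) := by
  refine (Runs.for (T := 100) (fun k τ => ∀ j < k, τ.nat 2 j 0 = digitPoint n (σ.nat 1 j 0) ∧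
        τ.real 7 j 0 = digitValue n (σ.nat 1 j 0)) hC.dim (by decide) (by decide) (by norm_num)
        (fun _ _ _ h => h) (by simp) ?_).le (by omega)
  intro k hk τ hF h10 hI
  have h0 : τ.var 0 = n := by rw [hF.var 0 (by decide), hC.var_n]
  have h1 : τ.nat 1 = σ.nat 1 := hF.nat 1 (by decide)
  have hz : (digitExp 10).eval τ = σ.nat 1 k 0 := by simp [digitExp, NExp.eval, h10, h1]
  have key : ∀ (e : NExp) (c : ℤ), e.eval τ = digitPoint n (σ.nat 1 k 0) →
      (c : ℝ) = digitValue n (σ.nat 1 k 0) →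
      Runs E (.setNat 2 (.var 10) (.const 0) e ;; .setReal 7 (.var 10) (.const 0) (.const c)) τ
        (8 + e.cost) (fun τ' => ∀ j < k + 1, τ'.nat 2 j 0 = digitPoint n (σ.nat 1 j 0) ∧
        τ'.real 7 j 0 = digitValue n (σ.nat 1 j 0)) := by
    intro e c he hc
    refine Runs.le (.seq (.setNat (.setReal ?_))) (by simp [NExp.cost, RExp.cost]; omega)
    intro j hj
    by_cases hjk : j = k
    · subst hjk
      simp [put, NExp.eval, RExp.eval, h10, he, hc]
    · simpa [put, NExp.eval, h10, hjk] using hI j (by omega)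
  refine Runs.le (.ite (fun hb => .ite (fun hb' => key _ _ ?_ ?_) fun hb' => key _ _ ?_ ?_)
    fun hb => key _ _ ?_ ?_) (by simp [NExp.cost, Test.cost, digitExp])
  all_goals
    simp only [Test.holds, NExp.eval, hz, h0] at hb
  · simp only [Test.holds, NExp.eval, hz, h0] at hb'
    simp [digitPoint, NExp.eval, hz, h0, hb, hb']
  · simp only [Test.holds, NExp.eval, hz, h0] at hb'
    simp [digitValue, hb, hb']
  · simp only [Test.holds, NExp.eval, hz, h0] at hb'
    simp [digitPoint, NExp.eval, hz, h0, hb, hb']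
  · simp only [Test.holds, NExp.eval, hz, h0] at hb'
    simp [digitValue, hb, hb']
  · simp [digitPoint, hz, hb]
  · simp [digitValue, hb]

theorem eval_gramExp (hC : Ctx d s K τ) {e : Fin n} (he : τ.nat 1 ((K.rank + 1).choose 2) 0 = e)
    {i j : NExp} {i' j' : Fin n} (hi : i.eval τ = i') (hj : j.eval τ = j') :
    (gramExp i j).eval τ = centeredGram K e i' j' := by
  simp [gramExp, squareExp, centeredGram, digitExp, RExp.eval, NExp.eval, hi, hj, hC.dim, he,
    hC.mat]

theorem runs_keySumProg {D : ℕ} (hD : (K.rank + 1).choose 2 = D) (hC : Ctx d s K σ) {e i : Fin n}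
    {t : Fin D → Fin n} {y w : Fin D → ℝ} {U : Fin D → Fin D → ℝ} (he : σ.nat 1 D 0 = e)
    (ht : ∀ k : Fin D, σ.nat 2 k 0 = t k) (hy : ∀ k : Fin D, σ.real 7 k 0 = y k)
    (hw : ∀ j : Fin D, σ.real 2 j 0 = w j) (hU : ∀ k j : Fin D, σ.real 3 k j = U k j)
    (hi : σ.var 10 = i) :
    Runs E keySumProg σ (20 * (D + 1) * (20 * (D + 1) * (20 * (D + 1) * 100))) (fun τ =>
      τ.acc = σ.acc +
        ∑ j, ∑ k, ∑ l, U k j * centeredGram K e (t k) i * (U l j * y l) / w j) := by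
  refine Runs.forSum (N := D)
    (fun j => ∑ k, ∑ l, U k j * centeredGram K e (t k) i * (U l j * y l) / w j) ?_
    (by decide) (by decide) (by nlinarith) fun j τ₁ hF₁ hj => ?_
  · rw [hC.dim, hD]
  refine Runs.forSum (N := D)
    (fun k => ∑ l, U k j * centeredGram K e (t k) i * (U l j * y l) / w j) ?_
    (by decide) (by decide) (by nlinarith) fun k τ₂ hF₂ hk => ?_
  · rw [hF₁.var 5 (by decide), hC.dim, hD]
  refine Runs.forSum (N := D)
    (fun l => U k j * centeredGram K e (t k) i * (U l j * y l) / w j) ?_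
    (by decide) (by decide) (by norm_num) fun l τ₃ hF₃ hl => (Runs.accum ?_).le (by decide)
  · rw [hF₂.var 5 (by decide), hF₁.var 5 (by decide), hC.dim, hD]
  have hC₃ : Ctx d s K τ₃ := ((hC.frame hF₁ (by decide) (by decide)).frame hF₂ (by decide)
    (by decide)).frame hF₃ (by decide) (by decide)
  have h10 : τ₃.var 10 = i := by
    rw [hF₃.var 10 (by decide), hF₂.var 10 (by decide), hF₁.var 10 (by decide), hi]
  have h11 : τ₃.var 11 = j := by
    rw [hF₃.var 11 (by decide), hF₂.var 11 (by decide), hj]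
  have h12 : τ₃.var 12 = k := by rw [hF₃.var 12 (by decide), hk]
  have hnat : ∀ a, τ₃.nat a = σ.nat a := fun a => by
    rw [hF₃.nat a (by simp [Prog.nats, Prog.accum]), hF₂.nat a (by simp [Prog.nats, Prog.accum]),
      hF₁.nat a (by simp [Prog.nats, Prog.accum])]
  have hreal : ∀ a ≠ 6, τ₃.real a = σ.real a := fun a ha => by
    rw [hF₃.real a (by simpa [Prog.reals, Prog.accum]),
      hF₂.real a (by simpa [Prog.reals, Prog.accum]), hF₁.real a (by simpa [Prog.reals, Prog.accum])]
  have hg := eval_gramExp hC₃ (e := e) (by rw [hnat, hD, he]) (i := pointExp 12) (j := .var 10)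
    (i' := t k) (j' := i) (by simp [pointExp, NExp.eval, h12, hnat, ht]) (by simp [NExp.eval, h10])
  simp [RExp.eval, NExp.eval, hg, h11, h12, hl, hreal, hU, hy, hw]

theorem runs_keysProg {D : ℕ} (hD : (K.rank + 1).choose 2 = D) (hC : Ctx d s K σ) {e : Fin n}
    {t : Fin D → Fin n} {y : Fin D → ℝ} (he : σ.nat 1 D 0 = e)
    (ht : ∀ k : Fin D, σ.nat 2 k 0 = t k) (hy : ∀ k : Fin D, σ.real 7 k 0 = y k) :
    Runs E keysProg σ (50000000 * ((n + 1) * (D + 1) ^ 3)) (fun τ =>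
      ∀ i : Fin n, τ.real 5 i 0 = candidateKey E K e t y i) := by
  let M : Matrix (Fin D) (Fin D) ℝ := of fun k l => centeredGram K e (t k) (t l)
  refine Runs.le (.seq (T₁ := 400 * (D + 1) ^ 2 * 200) (T₂ := 1 + (1 + 1 + D ^ 3) + 20 * (n + 1) *
    (20 * (D + 1) * (20 * (D + 1) * (20 * (D + 1) * 100)) + 50)) ((Runs.fill (N := D)
    (fun k l => centeredGram K e (t k) (t l)) (hC.dim.trans hD) (by decide) ?_).mono
    (Nat.mul_le_mul_left _ (by decide)) fun σ₁ hF₁ hM => ?_)) ?_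
  · intro τ hF i j h10 h11
    have h2 : τ.nat 2 = σ.nat 2 := hF.nat 2 (by decide)
    refine eval_gramExp (hC.frame hF (by decide) (by decide)) ?_ ?_ ?_
    · rw [hF.nat 1 (by decide), hD, he]
    · simp [pointExp, NExp.eval, h10, h2, ht]
    · simp [pointExp, NExp.eval, h11, h2, ht]
  · have hC₁ := hC.frame hF₁ (by decide) (by decide)
    refine .seq ((Runs.eig' (N := D) M
      (by simp [NExp.eval, hC₁.dim, hD]) (by decide) hM).mono le_rfl fun σ₂ hF₂ ⟨hw, hU⟩ => ?_)
    have hC₂ := hC₁.frame hF₂ (by decide) (by decide)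
    refine (Runs.for (fun k τ => ∀ i : Fin n, (i : ℕ) < k →
      τ.real 5 i 0 = candidateKey E K e t y i) hC₂.var_n (by decide) (by decide)
      (by omega) (fun _ _ _ h => h) (by simp) ?_).mono le_rfl
      fun τ _ h i => h i i.2
    intro i hi τ hF h10 hI
    have hC₃ := hC₂.frame hF (by decide) (by decide)
    have hnat : ∀ a, τ.nat a = σ.nat a := fun a => by
      rw [hF.nat a (by simp [Prog.nats, Prog.zeroAcc, keySumProg, Prog.accum]),
        hF₂.nat a (by simp [Prog.nats]), hF₁.nat a (by simp [Prog.nats, Prog.fill])]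
    have hreal : ∀ a ∈ [2, 3], τ.real a = σ₂.real a := fun a ha => by
      rw [hF.real a (by revert a; decide)]
    have h7 : τ.real 7 = σ.real 7 := by
      rw [hF.real 7 (by decide), hF₂.real 7 (by decide), hF₁.real 7 (by decide)]
    refine Runs.le (.seq (Runs.zeroAcc.mono le_rfl fun τ₁ hF₃ h0 => .seq ((runs_keySumProg
      (i := ⟨i, hi⟩) (e := e) (t := t) (y := y) (w := E.vals M) (U := E.vecs M) hD
      (hC₃.frame hF₃ (by decide) (by decide)) ?_ (fun k => ?_) (fun k => ?_) (fun j => ?_)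
      (fun k j => ?_) ?_).mono le_rfl fun τ₂ hF₄ hacc => .setReal fun j hj => ?_))) (by
        simp only [NExp.cost, RExp.cost]
        omega)
    · rw [hF₃.nat 1 (by decide), hnat, he]
    · rw [hF₃.nat 2 (by decide), hnat, ht]
    · rw [hF₃.real 7 (by decide), h7, hy]
    · rw [hF₃.real 2 (by decide), hreal 2 (by decide)]
      exact hw j
    · rw [hF₃.real 3 (by decide), hreal 3 (by decide)]
      exact hU k j
    · rw [hF₃.var 10 (by decide), h10]
    · have h10' : τ₂.var 10 = i := by rw [hF₄.var 10 (by decide), hF₃.var 10 (by decide), h10]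
      rw [h0, zero_add] at hacc
      by_cases hji : (j : ℕ) = i
      · obtain rfl : j = ⟨i, hi⟩ := Fin.ext hji
        have hacc' : τ₂.acc = candidateKey E K e t y ⟨i, hi⟩ := hacc
        simpa [put, NExp.eval, RExp.eval, h10', State.acc] using hacc'
      · simpa [put, NExp.eval, h10', hji, hF₄.real 5 (by decide), hF₃.real 5 (by decide)] using
          hI j (by omega)
  · have h₁ : (D + 1) ^ 2 ≤ (n + 1) * (D + 1) ^ 3 := by
      have : (D + 1) ^ 2 * 1 ≤ (D + 1) ^ 2 * ((D + 1) * (n + 1)) :=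
        Nat.mul_le_mul_left _ (Nat.mul_pos (by omega) (by omega))
      linarith
    have h₂ : D ^ 3 ≤ (n + 1) * (D + 1) ^ 3 := by
      have := Nat.pow_le_pow_left (Nat.le_succ D) 3
      have h := Nat.mul_le_mul_right ((D + 1) ^ 3) (Nat.succ_le_succ (Nat.zero_le n))
      simp only [Nat.succ_eq_add_one] at *
      linarith
    have h₃ : n + 1 ≤ (n + 1) * (D + 1) ^ 3 := Nat.le_mul_of_pos_right _ (by positivity)
    have h₄ : 20 * (n + 1) * (20 * (D + 1) * (20 * (D + 1) * (20 * (D + 1) * 100)) + 50) =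
      16000000 * ((n + 1) * (D + 1) ^ 3) + 1000 * (n + 1) := by ring
    rw [h₄]
    omega

/-! ### Selection -/

/-- The first entries of row `m` of the array of candidates are the elements of `A`; their number is
in variable `9`. -/
def Listed (m : ℕ) (A : Finset ℕ) (τ : State) : Prop :=
  τ.var 9 = A.card ∧ (Finset.range A.card).image (τ.nat 0 m) = A

/-- The last alternative drives the selection: an index passing the test is left out only if the
candidate is full. -/
theorem runs_passProg {b : Test} {m : ℕ} {A₀ : Finset ℕ} {P : ℕ → Prop} (hm : σ.var 3 = m)
    (hn : σ.var 0 = n) (hs : σ.var 2 = s) (hA : Listed m A₀ σ) (hA₀ : A₀.card ≤ s)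
    (hdisj : ∀ i ∈ A₀, ¬ P i)
    (hP : ∀ τ, Frame (passProg b) σ τ → ∀ i < n, τ.var 10 = i → (b.holds τ ↔ P i)) :
    Runs E (passProg b) σ (20 * (n + 1) * (b.cost + 50)) (fun τ =>
      (∀ m' ≠ m, τ.nat 0 m' = σ.nat 0 m') ∧ ∃ A, Listed m A τ ∧ A.card ≤ s ∧ A₀ ⊆ A ∧
        (∀ i ∈ A, i ∈ A₀ ∨ i < n ∧ P i) ∧ (A.card = s ∨ ∀ i < n, P i → i ∈ A)) := by
  refine Runs.for (fun k τ => (∀ m' ≠ m, τ.nat 0 m' = σ.nat 0 m') ∧ ∃ A, Listed m A τ ∧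
    A.card ≤ s ∧ A₀ ⊆ A ∧ (∀ i ∈ A, i ∈ A₀ ∨ i < k ∧ P i) ∧ (A.card = s ∨ ∀ i < k, P i → i ∈ A))
    hn (by simp [Prog.vars]) (by simp [Prog.vars]) (by omega) (fun k τ x h => by simpa [Listed] using h)
    ⟨fun _ _ => rfl, A₀, hA, hA₀, subset_rfl, fun i hi => Or.inl hi, by simp⟩ ?_
  rintro k hk τ hF h10 ⟨hrow, A, ⟨h9, himg⟩, hcard, hsub, hmem, hfull⟩
  have hb := hP τ hF k hk h10
  have h2 : τ.var 2 = s := by rw [hF.var 2 (by simp [Prog.vars]), hs]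
  have h3 : τ.var 3 = m := by rw [hF.var 3 (by simp [Prog.vars]), hm]
  have hmem' : ∀ i ∈ A, i ∈ A₀ ∨ i < k + 1 ∧ P i := fun i hi =>
    (hmem i hi).imp_right fun h => ⟨by omega, h.2⟩
  refine Runs.le (.ite (fun h => .seq (.setNat (.setVar ?_))) fun h => .skip ?_) (by
    simp only [Test.cost, NExp.cost]
    omega)
  · simp only [Test.holds, NExp.eval, h2, h9, not_le, hb] at h
    have hkA : k ∉ A := fun hkA => by
      rcases hmem k hkA with h' | h'
      · exact hdisj k h' h.1
      · omega
    refine ⟨fun m' hm' => ?_, insert k A, ⟨?_, ?_⟩, ?_, ?_, ?_, ?_⟩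
    · funext j
      simp [put, NExp.eval, h3, hm', hrow m' hm']
    · simp [NExp.eval, h9, Finset.card_insert_of_notMem hkA]
    · rw [Finset.card_insert_of_notMem hkA, Finset.range_add_one, Finset.image_insert]
      congr 1
      · simp [put, NExp.eval, h3, h9, h10]
      · conv_rhs => rw [← himg]
        refine Finset.image_congr fun i hi => ?_
        have : i ≠ A.card := by
          simp at hi
          omega
        simp [put, NExp.eval, h3, h9, this]
    · rw [Finset.card_insert_of_notMem hkA]
      exact h.2
    · exact hsub.trans (Finset.subset_insert _ _)
    · intro i hi
      rcases Finset.mem_insert.1 hi with rfl | hi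
      · exact Or.inr ⟨by omega, h.1⟩
      · exact hmem' i hi
    · refine Or.inr fun i hi hPi => ?_
      rcases Nat.lt_succ_iff_lt_or_eq.1 hi with hi | rfl
      · rcases hfull with h' | h'
        · omega
        · exact Finset.mem_insert_of_mem (h' i hi hPi)
      · exact Finset.mem_insert_self _ _
  · simp only [Test.holds, NExp.eval, h2, h9, not_le, hb, not_and, not_lt] at h
    refine ⟨hrow, A, ⟨h9, himg⟩, hcard, hsub, hmem', ?_⟩
    rcases hfull with h' | h'
    · exact Or.inl h'
    · by_cases hPk : P k
      · exact Or.inl (le_antisymm hcard (h hPk))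
      · refine Or.inr fun i hi hPi => ?_
        rcases Nat.lt_succ_iff_lt_or_eq.1 hi with hi | rfl
        · exact h' i hi hPi
        · exact absurd hPi hPk

/-- Positive keys are taken first, then zero keys, then negative ones. An omitted positive key means
that the first pass filled the candidate; an omitted zero key, that the first two did. Together the
passes cover all indices, so `s` of them are found. -/
theorem runs_selectProg (hC : Ctx d s K σ) (hsn : s < n) {m : ℕ} (hm : σ.var 3 = m)
    {key : Fin n → ℝ} (hkey : ∀ i : Fin n, σ.real 5 i 0 = key i) :
    Runs E selectProg σ (5000 * (n + 1)) (fun τ =>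
      (∀ m' ≠ m, τ.nat 0 m' = σ.nat 0 m') ∧ ∃ c : Fin s → Fin n, c.Injective ∧
        SelectsSigns key c ∧ ∀ l : Fin s, τ.nat 0 m l = c l) := by
  have hle : ∀ τ : State, τ.real 5 = σ.real 5 → ∀ i (hi : i < n), τ.var 10 = i →
      (keyLe.holds τ ↔ key ⟨i, hi⟩ ≤ 0) := by
    intro τ h5 i hi h10
    simp [keyLe, Test.holds, RExp.eval, NExp.eval, h10, h5, ← hkey]
  have hge : ∀ τ : State, τ.real 5 = σ.real 5 → ∀ i (hi : i < n), τ.var 10 = i →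
      (keyGe.holds τ ↔ 0 ≤ key ⟨i, hi⟩) := by
    intro τ h5 i hi h10
    simp [keyGe, Test.holds, RExp.eval, NExp.eval, h10, h5, ← hkey]
  have h0 := hC.var_n
  have h2 := hC.var_s
  refine Runs.le (.seq (Runs.mono (Q := fun τ => τ.var 9 = 0) (.setVar (by simp [NExp.eval]))
    le_rfl fun σ₀ hF₀ h9 => .seq ?_)) (T := 1 + (1 + 1) + (1 + 20 * (n + 1) * 70 +
      (1 + 20 * (n + 1) * 70 + 20 * (n + 1) * 70))) (by omega)
  have hr₀ := hF₀.real 5 (by decide)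
  refine (runs_passProg (A₀ := ∅) (s := s) (n := n) (m := m)
    (P := fun i => ∃ hi : i < n, 0 < key ⟨i, hi⟩) ?_ ?_ ?_ ?_ ?_ ?_ ?_).mono
    (Nat.mul_le_mul_left _ (by decide))
    fun σ₁ hF₁ ⟨hrow₁, A₁, hL₁, hs₁, hsub₁, hmem₁, hfull₁⟩ => .seq ?_
  · rw [hF₀.var 3 (by decide), hm]
  · rw [hF₀.var 0 (by decide), h0]
  · rw [hF₀.var 2 (by decide), h2]
  · simp [Listed, h9]
  · simp
  · simp
  · intro τ hF i hi h10
    have := hle τ (by rw [hF.real 5 (by decide), hr₀]) i hi h10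
    simp [Test.holds, this, hi]
  have hr₁ := (hF₁.real 5 (by decide)).trans hr₀
  refine (runs_passProg (s := s) (n := n) (m := m)
    (P := fun i => ∃ hi : i < n, key ⟨i, hi⟩ = 0) ?_ ?_ ?_ hL₁ hs₁ ?_ ?_).mono
    (Nat.mul_le_mul_left _ (by decide))
    fun σ₂ hF₂ ⟨hrow₂, A₂, hL₂, hs₂, hsub₂, hmem₂, hfull₂⟩ => ?_
  · rw [hF₁.var 3 (by decide), hF₀.var 3 (by decide), hm]
  · rw [hF₁.var 0 (by decide), hF₀.var 0 (by decide), h0]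
  · rw [hF₁.var 2 (by decide), hF₀.var 2 (by decide), h2]
  · intro i hi ⟨hin, h⟩
    rcases hmem₁ i hi with h' | ⟨-, _, h'⟩
    · simp at h'
    · exact h'.ne' h
  · intro τ hF i hi h10
    have h₁ := hle τ (by rw [hF.real 5 (by decide), hr₁]) i hi h10
    have h₂ := hge τ (by rw [hF.real 5 (by decide), hr₁]) i hi h10
    simp [Test.holds, h₁, h₂, hi, le_antisymm_iff]
  have hr₂ := (hF₂.real 5 (by decide)).trans hr₁
  refine (runs_passProg (s := s) (n := n) (m := m)
    (P := fun i => ∃ hi : i < n, key ⟨i, hi⟩ < 0) ?_ ?_ ?_ hL₂ hs₂ ?_ ?_).mono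
    (Nat.mul_le_mul_left _ (by decide))
    fun σ₃ hF₃ ⟨hrow₃, A₃, hL₃, hs₃, hsub₃, hmem₃, hfull₃⟩ => ?_
  · rw [hF₂.var 3 (by decide), hF₁.var 3 (by decide), hF₀.var 3 (by decide), hm]
  · rw [hF₂.var 0 (by decide), hF₁.var 0 (by decide), hF₀.var 0 (by decide), h0]
  · rw [hF₂.var 2 (by decide), hF₁.var 2 (by decide), hF₀.var 2 (by decide), h2]
  · intro i hi ⟨hin, h⟩
    rcases hmem₂ i hi with h' | ⟨-, _, h'⟩
    · rcases hmem₁ i h' with h' | ⟨-, _, h'⟩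
      · simp at h'
      · exact h'.not_gt h
    · exact h.ne h'
  · intro τ hF i hi h10
    have := hge τ (by rw [hF.real 5 (by decide), hr₂]) i hi h10
    simp [Test.holds, this, hi]
  have hpos : ∀ i ∈ A₁, ∃ hi : i < n, 0 < key ⟨i, hi⟩ := fun i hi => by
    simpa using hmem₁ i hi
  have hnonneg : ∀ i ∈ A₂, ∃ hi : i < n, 0 ≤ key ⟨i, hi⟩ := fun i hi => by
    rcases hmem₂ i hi with h | ⟨hi, _, h⟩
    · obtain ⟨hi, h⟩ := hpos i h
      exact ⟨hi, h.le⟩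
    · exact ⟨hi, h.ge⟩
  have hlt : ∀ i ∈ A₃, i < n := fun i hi => by
    rcases hmem₃ i hi with h | h
    · exact (hnonneg i h).1
    · exact h.1
  -- once the room is used up, the later passes add nothing
  have h₂₁ : A₁.card = s → A₂ = A₁ := fun h =>
    (Finset.eq_of_subset_of_card_le hsub₂ (by omega)).symm
  have h₃₂ : A₂.card = s → A₃ = A₂ := fun h =>
    (Finset.eq_of_subset_of_card_le hsub₃ (by omega)).symm
  have hcard : A₃.card = s := by
    rcases hfull₃ with h | h₃
    · exact h
    rcases hfull₂ with h | h₂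
    · rw [h₃₂ h, h]
    rcases hfull₁ with h | h₁
    · rw [h₃₂ (by rw [h₂₁ h, h]), h₂₁ h, h]
    have huniv : Finset.range n ⊆ A₃ := by
      intro i hi
      have hi' : i < n := Finset.mem_range.1 hi
      rcases lt_trichotomy (key ⟨i, hi'⟩) 0 with h | h | h
      · exact h₃ i hi' ⟨hi', h⟩
      · exact hsub₃ (h₂ i hi' ⟨hi', h⟩)
      · exact hsub₃ (hsub₂ (h₁ i hi' ⟨hi', h⟩))
    have := Finset.card_le_card huniv
    rw [Finset.card_range] at this
    omega
  obtain ⟨-, himg⟩ := hL₃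
  have hmemA : ∀ l < s, σ₃.nat 0 m l ∈ A₃ := fun l hl => by
    have := Finset.mem_image_of_mem (σ₃.nat 0 m) (show l ∈ Finset.range A₃.card by simpa [hcard])
    rwa [himg] at this
  -- The first `s` entries have `s` distinct values, so the row has no repetition.
  have hinj : Set.InjOn (σ₃.nat 0 m) (Finset.range A₃.card) :=
    Finset.injOn_of_card_image_eq (by rw [himg, Finset.card_range])
  let c : Fin s → Fin n := fun l => ⟨σ₃.nat 0 m l, hlt _ (hmemA l l.2)⟩
  have hrange : ∀ i : Fin n, i ∈ Set.range c ↔ (i : ℕ) ∈ A₃ := by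
    intro i
    constructor
    · rintro ⟨l, rfl⟩
      exact hmemA l l.2
    · intro hi
      rw [← himg] at hi
      obtain ⟨l, hl, hli⟩ := Finset.mem_image.1 hi
      exact ⟨⟨l, by simpa [hcard] using hl⟩, Fin.ext hli⟩
  refine ⟨fun m' hm' => ?_, c, fun l l' hl => ?_, fun i hi l => ⟨fun hki => ?_, fun hki => ?_⟩,
    fun l => rfl⟩
  · rw [hrow₃ m' hm', hrow₂ m' hm', hrow₁ m' hm', hF₀.nat 0 (by decide)]
  · refine Fin.ext (hinj ?_ ?_ (congrArg Fin.val hl))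
    · simp [hcard]
    · simp [hcard]
  · rw [hrange] at hi
    have hi₁ : (i : ℕ) ∉ A₁ := fun h => hi (hsub₃ (hsub₂ h))
    have hs₁ : A₁.card = s := hfull₁.resolve_right fun h => hi₁ (h i i.2 ⟨i.2, hki⟩)
    have hA : A₃ = A₁ := by rw [h₃₂ (by rw [h₂₁ hs₁, hs₁]), h₂₁ hs₁]
    exact (hpos _ (hA ▸ hmemA l l.2)).2
  · rw [hrange] at hi
    have hs₂ : A₂.card = s := by
      rcases hki.eq_or_lt with h | h
      · exact hfull₂.resolve_right fun h' => hi (hsub₃ (h' i i.2 ⟨i.2, h.symm⟩))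
      · have hi₁ : (i : ℕ) ∉ A₁ := fun h => hi (hsub₃ (hsub₂ h))
        have hs₁ : A₁.card = s := hfull₁.resolve_right fun h' => hi₁ (h' i i.2 ⟨i.2, h⟩)
        rw [h₂₁ hs₁, hs₁]
    exact (hnonneg _ (h₃₂ hs₂ ▸ hmemA l l.2)).2

/-! ### Evaluation of a candidate -/

theorem runs_submatrixProg {row m : ℕ} (hrow : row ≠ 10 ∧ row ≠ 11) (hC : Ctx d s K σ)
    (hm : σ.var row = m) {c : Fin s → Fin n} (hc : ∀ l : Fin s, σ.nat 0 m l = c l) :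
    Runs E (submatrixProg row) σ (10000 * (s + 1) ^ 3) (fun τ =>
      (∀ j : Fin s, τ.real 2 j 0 = E.vals (K.submatrix c c) j) ∧
        ∀ i j : Fin s, τ.real 3 i j = E.vecs (K.submatrix c c) i j) := by
  refine Runs.le (.seq (T₁ := 400 * (s + 1) ^ 2 * 20) (T₂ := 1 + 1 + s ^ 3)
    ((Runs.fill (N := s) (fun i j => K (c i) (c j)) hC.var_s (by decide) ?_).mono
    (Nat.mul_le_mul_left _ (by simp [RExp.cost, NExp.cost])) fun σ₁ hF₁ hM => ?_)) ?_
  · intro τ hF i j h10 h11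
    have hC' := hC.frame hF (by simp [Prog.vars, Prog.fill]) (by simp [Prog.reals, Prog.fill])
    have hv : τ.var row = m := by
      rw [hF.var row (by simp [Prog.vars, Prog.fill, hrow.1, hrow.2]), hm]
    have h0 : τ.nat 0 = σ.nat 0 := hF.nat 0 (by simp [Prog.nats, Prog.fill])
    simp [RExp.eval, NExp.eval, hv, h10, h11, h0, hc, hC'.mat]
  · refine Runs.eig' (N := s) (K.submatrix c c) ?_ (by decide) hM
    have hC' := hC.frame hF₁ (by simp [Prog.vars, Prog.fill]) (by simp [Prog.reals, Prog.fill])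
    simp [NExp.eval, hC'.var_s]
  · have h₁ : (s + 1) ^ 2 ≤ (s + 1) ^ 3 := Nat.pow_le_pow_right (by omega) (by omega)
    have h₂ : s ^ 3 ≤ (s + 1) ^ 3 := Nat.pow_le_pow_left (by omega) 3
    have h₃ : 1 ≤ (s + 1) ^ 3 := Nat.one_le_pow _ _ (by omega)
    omega

/-- The cost of an eigenvalue decomposition, which is not needed if the rank is at most `d`. -/
def valueCost (n d r : ℕ) : ℕ := if r ≤ d then 0 else (n + 1) ^ 3

/-- If the rank is at most `d`, all nonzero eigenvalues count and the value is the trace. Avoiding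
the decomposition is essential in rank one, where a cubic cost per candidate would exceed the
claimed time. -/
theorem runs_valueProg {m : ℕ} (hK : K.PosSemidef) (h : d ≤ s) (hsn : s < n) (hC : Ctx d s K σ)
    (hm : σ.var 3 = m) {c : Fin s → Fin n} (hc : ∀ l : Fin s, σ.nat 0 m l = c l) :
    Runs E valueProg σ (20000 * ((n + 1) + valueCost n d K.rank)) (fun τ =>
      τ.acc = supportValue E K h c) := by
  have hvar : ∀ τ, Frame .zeroAcc σ τ → τ.var = σ.var := fun τ hF => by
    funext v
    exact hF.var v (by simp [Prog.vars, Prog.zeroAcc])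
  by_cases hr : K.rank ≤ d
  · refine Runs.le (.seq (Runs.zeroAcc.mono le_rfl fun σ₁ hF₁ h0 => .ite (fun _ => ?_)
      (T₁ := 20 * (s + 1) * 50) (T₂ := 0) fun hb => absurd ?_ hb)) (by
        simp only [valueCost, if_pos hr, Test.cost, NExp.cost]
        omega)
    · have hC₁ := hC.frame hF₁ (by decide) (by decide)
      refine (Runs.forSum (fun l : Fin s => K (c l) (c l)) hC₁.var_s (by decide) (by decide)
        (by omega) fun l τ hF h10 => (Runs.accum ?_).le (by decide)).mono le_rfl
        fun τ _ hacc => ?_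
      · have hC₂ := hC₁.frame hF (by decide) (by decide)
        have h3 : τ.var 3 = m := by rw [hF.var 3 (by decide), hvar _ hF₁, hm]
        have h0 : τ.nat 0 = σ.nat 0 := (hF.nat 0 (by decide)).trans (hF₁.nat 0 (by decide))
        simp [RExp.eval, NExp.eval, h3, h10, h0, hc, hC₂.mat]
      · rw [hacc, h0, zero_add, supportValue, E.topSum_eq_trace (hK.submatrix c) h]
        · rfl
        · exact (rank_submatrix_le _ _ _).trans hr
    · simp [Test.holds, NExp.eval, hvar _ hF₁, hC.rank, hC.var_d, hr]
  · refine Runs.le (.seq (Runs.zeroAcc.mono le_rfl fun σ₁ hF₁ h0 => .ite (fun hb => absurd hb ?_)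
      (T₁ := 0) (T₂ := 1 + 10000 * (s + 1) ^ 3 + 20 * (d + 1) * 50) fun _ => ?_)) ?_
    · simp [Test.holds, NExp.eval, hvar _ hF₁, hC.rank, hC.var_d, hr]
    · have hC₁ := hC.frame hF₁ (by decide) (by decide)
      refine .seq ((runs_submatrixProg (m := m) (by decide) hC₁ ?_ (c := c) ?_).mono le_rfl
        fun σ₂ hF₂ ⟨hw, _⟩ => ?_)
      · rw [hvar _ hF₁, hm]
      · rw [hF₁.nat 0 (by decide)]
        exact hc
      have hC₂ := hC₁.frame hF₂ (by decide) (by decide)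
      refine (Runs.forSum (fun l : Fin d => E.vals (K.submatrix c c) (Fin.castLE h l)) hC₂.var_d
        (by decide) (by decide) (by omega) fun l τ hF h10 => (Runs.accum ?_).le (by decide)).mono
        le_rfl fun τ _ hacc => ?_
      · have := hw (Fin.castLE h l)
        simpa [RExp.eval, NExp.eval, h10, hF.real 2 (by decide)] using this
      · have h6 : σ₂.acc = 0 := by
          rw [State.acc, hF₂.real 6 (by decide)]
          exact h0
        rw [hacc, h6, zero_add]
        rfl
    · have : (s + 1) ^ 3 ≤ (n + 1) ^ 3 := Nat.pow_le_pow_left (by omega) 3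
      simp only [valueCost, if_neg hr, Test.cost, NExp.cost]
      omega

theorem runs_bestProg :
    Runs E bestProg σ 50 (fun τ =>
      (σ.acc ≤ σ.real 8 0 0 ∧ τ.var 8 = σ.var 8 ∧ τ.real 8 0 0 = σ.real 8 0 0) ∨
      (σ.real 8 0 0 < σ.acc ∧ τ.var 8 = σ.var 3 ∧ τ.real 8 0 0 = σ.acc)) := by
  refine Runs.le (.ite (fun h => .skip (Or.inl ⟨?_, rfl, rfl⟩)) fun h =>
    .seq (.setReal (.setVar (Or.inr ⟨?_, ?_, ?_⟩)))) (by decide)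
  · simpa [Test.holds, RExp.eval, NExp.eval, State.acc] using h
  · simpa [Test.holds, RExp.eval, NExp.eval, State.acc] using h
  · simp [NExp.eval]
  · simp [put, RExp.eval, NExp.eval, State.acc]

/-! ### Counting in base `3 n` -/

/-- One column of schoolbook addition: `a` stands for what remains of the number from this digit on,
`c` for the incoming carry. -/
theorem carry_step {a c b : ℕ} (hb : 0 < b) (hc : c ≤ 1) :
    (b ≤ a % b + c → (a + c) % b = 0 ∧ a / b + 1 = (a + c) / b ∧ c = 1) ∧
      (¬ b ≤ a % b + c → (a + c) % b = a % b + c ∧ a / b = (a + c) / b) := by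
  have h₁ := Nat.mod_lt a hb
  have h₂ := Nat.div_add_mod a b
  constructor
  · intro h
    obtain rfl : c = 1 := by omega
    have h₃ : a + 1 = b * (a / b + 1) := by
      rw [mul_add, mul_one]
      omega
    rw [h₃]
    exact ⟨Nat.mul_mod_right _ _, (Nat.mul_div_cancel_left _ hb).symm, rfl⟩
  · intro h
    have h₃ : a + c = a % b + c + b * (a / b) := by omega
    conv in (a + c) % b => rw [h₃]
    conv in (a + c) / b => rw [h₃]
    rw [Nat.add_mul_mod_self_left, Nat.add_mul_div_left _ _ hb, Nat.mod_eq_of_lt (by omega),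
      Nat.div_eq_of_lt (show a % b + c < b by omega), zero_add]
    exact ⟨rfl, rfl⟩

/-- The digits of `m` in base `b` are stored: `D` of them, and what remains. -/
def HasDigits (b D m : ℕ) (σ : State) : Prop :=
  (∀ k < D, σ.nat 1 k 0 = m / b ^ k % b) ∧ σ.nat 1 D 0 = m / b ^ D

theorem runs_nextProg {b D m : ℕ} (hb : 0 < b) (hm : σ.var 3 = m) (h5 : σ.var 5 = D)
    (h7 : σ.var 7 = b) (hdig : HasDigits b D m σ) :
    Runs E nextProg σ (2000 * (D + 1)) (fun τ => τ.var 3 = m + 1 ∧ HasDigits b D (m + 1) τ) := by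
  refine Runs.le (.seq (Runs.mono (Q := fun τ => τ.var 14 = 1) (.setVar (by simp [NExp.eval]))
    le_rfl fun σ₀ hF₀ h14 => .seq (T₁ := 20 * (D + 1) * 50) ?_)) (T := 1 + (1 + 1) +
      (1 + 20 * (D + 1) * 50 + (1 + 8 + 8))) (by omega)
  -- The invariant says that the quotients of `m` and `m + 1` by `b ^ k` differ exactly by the
  -- carry. The top digit receives the final carry after the loop and is never reduced.
  refine (Runs.for (N := D) (fun k τ => (∀ j < k, τ.nat 1 j 0 = (m + 1) / b ^ j % b) ∧
    (∀ j, k ≤ j → τ.nat 1 j 0 = σ.nat 1 j 0) ∧ τ.var 14 ≤ 1 ∧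
    m / b ^ k + τ.var 14 = (m + 1) / b ^ k) ?_ (by decide) (by decide) (by norm_num)
    (fun k τ x h => by simpa using h) ⟨by simp, ?_, ?_, ?_⟩ ?_).mono le_rfl
    fun σ₁ hF₁ ⟨h₁, h₂, h₃, h₄⟩ => Runs.le (.seq (.setNat (.setVar ⟨?_, ?_, ?_⟩))) (by decide)
  · rw [hF₀.var 5 (by decide), h5]
  · rw [hF₀.nat 1 (by decide)]
    simp
  · rw [h14]
  · simp [h14]
  · rintro k hk τ hF h10 ⟨h₁, h₂, h₃, h₄⟩
    have h7' : τ.var 7 = b := by rw [hF.var 7 (by decide), hF₀.var 7 (by decide), h7]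
    have hdk : τ.nat 1 k 0 = m / b ^ k % b := by rw [h₂ k le_rfl, hdig.1 k hk]
    have hdiv : ∀ x, x / b ^ (k + 1) = x / b ^ k / b := fun x => by
      rw [pow_succ, Nat.div_div_eq_div_mul]
    obtain ⟨hs₁, hs₂⟩ := carry_step (a := m / b ^ k) hb h₃
    refine Runs.le (.ite (fun hb => .setNat ⟨fun j hj => ?_, fun j hj => ?_, h₃, ?_⟩) fun hb =>
      .seq (.setNat (.setVar ⟨fun j hj => ?_, fun j hj => ?_, ?_, ?_⟩))) (by decide)
    all_goals simp only [Test.holds, digitExp, NExp.eval, h7', h10, hdk] at hb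
    · obtain ⟨e₁, e₂, e₃⟩ := hs₁ hb
      by_cases hjk : j = k
      · subst hjk
        simp [put, NExp.eval, h10, ← h₄, e₁]
      · simpa [put, NExp.eval, h10, hjk] using h₁ j (by omega)
    · simpa [put, NExp.eval, h10, show j ≠ k by omega] using h₂ j (by omega)
    · obtain ⟨e₁, e₂, e₃⟩ := hs₁ hb
      simp only [hdiv]
      rw [← h₄, ← e₂, e₃]
    · obtain ⟨e₁, e₂⟩ := hs₂ hb
      by_cases hjk : j = k
      · subst hjk
        simp [put, NExp.eval, digitExp, h10, ← h₄, e₁, hdk]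
      · simpa [put, NExp.eval, h10, hjk] using h₁ j (by omega)
    · simpa [put, NExp.eval, h10, show j ≠ k by omega] using h₂ j (by omega)
    · simp [NExp.eval]
    · obtain ⟨e₁, e₂⟩ := hs₂ hb
      simp only [hdiv]
      rw [← h₄, ← e₂]
      simp [NExp.eval]
  · have : σ₁.var 3 = m := by rw [hF₁.var 3 (by decide), hF₀.var 3 (by decide), hm]
    simp [NExp.eval, this]
  · have h5' : σ₁.var 5 = D := by rw [hF₁.var 5 (by decide), hF₀.var 5 (by decide), h5]
    intro k hk
    simpa [put, NExp.eval, h5', hk.ne] using h₁ k hk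
  · have h5' : σ₁.var 5 = D := by rw [hF₁.var 5 (by decide), hF₀.var 5 (by decide), h5]
    simp [put, NExp.eval, digitExp, h5', h₂ D le_rfl, hdig.2, h₄]

/-- Surjectivity of the enumeration: any list of digits with an arbitrary leading digit `e` is met.
-/
theorem exists_digits {b : ℕ} : ∀ (D : ℕ) (z : Fin D → ℕ), (∀ k, z k < b) → ∀ e : ℕ,
    ∃ m, m / b ^ D = e ∧ ∀ k : Fin D, m / b ^ (k : ℕ) % b = z k
  | 0, _, _, e => ⟨e, by simp, fun k => k.elim0⟩
  | D + 1, z, hz, e => by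
    obtain ⟨m, hm, hk⟩ := exists_digits D (fun k => z k.succ) (fun k => hz _) e
    have hdiv : ∀ k : ℕ, (z 0 + b * m) / b ^ (k + 1) = m / b ^ k := by
      intro k
      rw [pow_succ', ← Nat.div_div_eq_div_mul,
        Nat.add_mul_div_left _ _ (Nat.zero_lt_of_lt (hz 0)), Nat.div_eq_of_lt (hz 0), zero_add]
    refine ⟨z 0 + b * m, by rw [hdiv, hm], fun k => ?_⟩
    refine Fin.cases ?_ (fun k => ?_) k
    · simp [Nat.mod_eq_of_lt (hz 0)]
    · rw [Fin.val_succ, hdiv, hk]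

theorem digitPoint_lt {z : ℕ} (hz : z < 3 * n) : digitPoint n z < n := by
  unfold digitPoint
  split_ifs <;> omega

theorem exists_digit (i : Fin n) {y : ℝ} (hy : y = 0 ∨ y = 1 ∨ y = -1) :
    ∃ z < 3 * n, digitPoint n z = i ∧ digitValue n z = y := by
  have := i.2
  rcases hy with rfl | rfl | rfl
  · exact ⟨i, by omega, by simp [digitPoint], by simp [digitValue]⟩
  · exact ⟨i + n, by omega, by simp [digitPoint], by simp [digitValue]⟩
  · exact ⟨i + (n + n), by omega, by simp [digitPoint, show n ≤ (i : ℕ) + (n + n) by omega],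
      by simp [digitValue, show n ≤ (i : ℕ) + (n + n) by omega]⟩

/-! ### The main loop -/

/-- The first `s` entries of row `m` of the array of candidates are the values of `c`. -/
def RowIs (m : ℕ) (c : Fin s → Fin n) (σ : State) : Prop :=
  c.Injective ∧ ∀ l : Fin s, σ.nat 0 m l = c l

/-- The support `c` is selected by the functional with number `m`. -/
def Selected (E : EigenSolver) (K : Matrix (Fin n) (Fin n) ℝ) (m : ℕ) (c : Fin s → Fin n) : Prop :=
  ∀ (e : Fin n) (t : Fin ((K.rank + 1).choose 2) → Fin n) (y : Fin ((K.rank + 1).choose 2) → ℝ),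
    m / (3 * n) ^ (K.rank + 1).choose 2 = e →
    (∀ k : Fin _, digitPoint n (m / (3 * n) ^ (k : ℕ) % (3 * n)) = t k) →
    (∀ k : Fin _, digitValue n (m / (3 * n) ^ (k : ℕ) % (3 * n)) = y k) →
    SelectsSigns (candidateKey E K e t y) c

/-- The state after `m` candidates have been treated. -/
structure Inv (E : EigenSolver) (K : Matrix (Fin n) (Fin n) ℝ) (h : d ≤ s) (m : ℕ) (σ : State) :
    Prop where
  ctx : Ctx d s K σ
  count : σ.var 3 = m
  digits : HasDigits (3 * n) ((K.rank + 1).choose 2) m σ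
  rows : ∀ m' < m, ∃ c : Fin s → Fin n, RowIs m' c σ ∧ Selected E K m' c ∧
    supportValue E K h c ≤ σ.real 8 0 0
  best : m = 0 ∧ σ.real 8 0 0 = -1 ∨ σ.var 8 < m ∧ ∃ c : Fin s → Fin n, RowIs (σ.var 8) c σ ∧
    supportValue E K h c = σ.real 8 0 0

/-- The time for one candidate, up to a constant. -/
def stepCost (n d r : ℕ) : ℕ := (n + 1) * ((r + 1).choose 2 + 1) ^ 3 + valueCost n d r

theorem runs_candidateProg (hK : K.PosSemidef) (h : d ≤ s) (hsn : s < n) {m : ℕ}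
    (hm : m < pivotCount n K.rank * (3 * n) ^ (K.rank + 1).choose 2) (hI : Inv E K h m σ) :
    Runs E candidateProg σ (100000000 * stepCost n d K.rank) (Inv E K h (m + 1)) := by
  obtain ⟨hC, h3, hdig, hrows, hbest⟩ := hI
  obtain ⟨D, hD⟩ : ∃ D, D = (K.rank + 1).choose 2 := ⟨_, rfl⟩
  have hb : 0 < 3 * n := by omega
  have he : m / (3 * n) ^ D < n := by
    rw [← hD] at hm
    refine lt_of_lt_of_le ((Nat.div_lt_iff_lt_mul (Nat.pow_pos hb)).2 hm) ?_
    unfold pivotCount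
    split_ifs <;> omega
  let e : Fin n := ⟨_, he⟩
  let t : Fin D → Fin n := fun k => ⟨digitPoint n (m / (3 * n) ^ (k : ℕ) % (3 * n)),
    digitPoint_lt (Nat.mod_lt _ hb)⟩
  let y : Fin D → ℝ := fun k => digitValue n (m / (3 * n) ^ (k : ℕ) % (3 * n))
  have hdig' := hdig
  rw [← hD] at hdig'
  refine Runs.le (.seq ((runs_decodeProg hC).mono (by rw [hD]) fun σ₁ hF₁ hdec => .seq
    ((runs_keysProg (e := e) (t := t) (y := y) hD.symm (hC.frame hF₁ (by decide) (by decide))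
    ?_ ?_ ?_).mono le_rfl fun σ₂ hF₂ hkey => .seq ((runs_selectProg
    ((hC.frame hF₁ (by decide) (by decide)).frame hF₂ (by decide) (by decide)) hsn (m := m) ?_
    hkey).mono le_rfl fun σ₃ hF₃ ⟨hother, c, hc, hsel, hrow⟩ => ?_)))) ?_
    (T := 1 + 2000 * (D + 1) + (1 + 50000000 * ((n + 1) * (D + 1) ^ 3) + (1 + 5000 * (n + 1) +
      (1 + 20000 * ((n + 1) + valueCost n d K.rank) + (1 + 50 + 2000 * (D + 1))))))
  · rw [hF₁.nat 1 (by decide)]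
    exact hdig'.2
  · intro k
    rw [(hdec k (hD ▸ k.2)).1, hdig'.1 k k.2]
  · intro k
    rw [(hdec k (hD ▸ k.2)).2, hdig'.1 k k.2]
  · rw [hF₂.var 3 (by decide), hF₁.var 3 (by decide), h3]
  · have hC₃ := ((hC.frame hF₁ (by decide) (by decide)).frame hF₂ (by decide) (by decide)).frame hF₃
      (by decide) (by decide)
    have h3₃ : σ₃.var 3 = m := by
      rw [hF₃.var 3 (by decide), hF₂.var 3 (by decide), hF₁.var 3 (by decide), h3]
    refine .seq ((runs_valueProg hK h hsn hC₃ h3₃ hrow).mono le_rfl fun σ₄ hF₄ hacc => .seq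
      (runs_bestProg.mono le_rfl fun σ₅ hF₅ hbest' => (runs_nextProg (b := 3 * n) (D := D) (m := m) hb
        ?_ ?_ ?_ ?_).mono le_rfl fun σ₆ hF₆ ⟨h3₆, hdig₆⟩ => ?_))
    · rw [hF₅.var 3 (by decide), hF₄.var 3 (by decide), h3₃]
    · rw [hF₅.var 5 (by decide), hF₄.var 5 (by decide), hC₃.dim, hD]
    · rw [hF₅.var 7 (by decide), hF₄.var 7 (by decide), hC₃.base]
    · have : σ₅.nat 1 = σ.nat 1 := by
        rw [hF₅.nat 1 (by decide), hF₄.nat 1 (by decide), hF₃.nat 1 (by decide),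
          hF₂.nat 1 (by decide), hF₁.nat 1 (by decide)]
      rwa [HasDigits, this]
    have hnat : σ₆.nat 0 = σ₃.nat 0 := by
      rw [hF₆.nat 0 (by decide), hF₅.nat 0 (by decide), hF₄.nat 0 (by decide)]
    have hold : ∀ m' < m, σ₆.nat 0 m' = σ.nat 0 m' := fun m' hm' => by
      rw [hnat, hother m' hm'.ne, hF₂.nat 0 (by decide), hF₁.nat 0 (by decide)]
    have h8 : σ₆.var 8 = σ₅.var 8 := hF₆.var 8 (by decide)
    have hr8 : σ₆.real 8 = σ₅.real 8 := hF₆.real 8 (by decide)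
    have h8' : σ₄.var 8 = σ.var 8 := by
      rw [hF₄.var 8 (by decide), hF₃.var 8 (by decide), hF₂.var 8 (by decide), hF₁.var 8 (by decide)]
    have hr8' : σ₄.real 8 = σ.real 8 := by
      rw [hF₄.real 8 (by decide), hF₃.real 8 (by decide), hF₂.real 8 (by decide),
        hF₁.real 8 (by decide)]
    have h3₄ : σ₄.var 3 = m := by rw [hF₄.var 3 (by decide), h3₃]
    rw [hacc, hr8', h8', h3₄] at hbest'
    have hmono : σ.real 8 0 0 ≤ σ₆.real 8 0 0 := by
      rw [hr8]
      rcases hbest' with ⟨-, -, h⟩ | ⟨h, -, h'⟩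
      · exact h.ge
      · rw [h']
        exact h.le
    have hrow₆ : RowIs m c σ₆ := ⟨hc, fun l => by rw [hnat, hrow]⟩
    refine ⟨((hC₃.frame hF₄ (by decide) (by decide)).frame hF₅ (by decide) (by decide)).frame hF₆
      (by decide) (by decide), h3₆, hD ▸ hdig₆, fun m' hm' => ?_, Or.inr ?_⟩
    · rcases Nat.lt_succ_iff_lt_or_eq.1 hm' with hlt | rfl
      · obtain ⟨c', ⟨hc', hrow'⟩, hsel', hval'⟩ := hrows m' hlt
        exact ⟨c', ⟨hc', fun l => by rw [hold m' hlt, hrow']⟩, hsel', hval'.trans hmono⟩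
      · refine ⟨c, hrow₆, ?_, ?_⟩
        · intro e' t' y' he' ht' hy'
          subst hD
          obtain rfl : e = e' := Fin.ext he'
          obtain rfl : t = t' := funext fun k => Fin.ext (ht' k)
          obtain rfl : y = y' := funext hy'
          exact hsel
        · rw [hr8]
          rcases hbest' with ⟨h₁, -, h₂⟩ | ⟨-, -, h₂⟩
          · rwa [h₂]
          · exact h₂.ge
    · rw [h8, hr8]
      rcases hbest' with ⟨h₁, h₂, h₃⟩ | ⟨-, h₂, h₃⟩
      · rw [h₂, h₃]
        rcases hbest with ⟨-, hneg⟩ | ⟨hlt, c', ⟨hc', hrow'⟩, hval'⟩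
        -- The initial best value `-1` is below every value, so the first candidate always replaces
        -- it.
        · have : 0 ≤ supportValue E K h c := by
            unfold supportValue topSum
            exact Finset.sum_nonneg fun l _ => E.vals_nonneg (hK.submatrix c) _
          linarith
        · exact ⟨by omega, c', ⟨hc', fun l => by rw [hold _ hlt, hrow']⟩, hval'⟩
      · rw [h₂, h₃]
        exact ⟨by omega, c, hrow₆, rfl⟩
  · have h₁ : D + 1 ≤ (n + 1) * (D + 1) ^ 3 := by
      have : (D + 1) * 1 ≤ (D + 1) * ((D + 1) ^ 2 * (n + 1)) :=
        Nat.mul_le_mul_left _ (Nat.mul_pos (by positivity) (by omega))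
      linarith
    have h₃ : n + 1 ≤ (n + 1) * (D + 1) ^ 3 := Nat.le_mul_of_pos_right _ (by positivity)
    simp only [stepCost, ← hD]
    omega

/-! ### The output -/

/-- Only rows in the support are written; the others are zero because the array of the solution is
still in its initial state. -/
theorem runs_outputProg {m : ℕ} (hC : Ctx d s K σ) (h : d ≤ s) (hm : σ.var 8 = m)
    {c : Fin s → Fin n} (hc : RowIs m c σ) (h1 : ∀ i j, σ.real 1 i j = 0) :
    Runs E outputProg σ (30000 * (s + 1) ^ 3) (fun τ =>
      rowSupport (τ.solution n d) ⊆ Set.range c ∧ ∀ l j,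
        τ.solution n d (c l) j = E.vecs (K.submatrix c c) l (Fin.castLE h j)) := by
  refine Runs.le (.seq ((runs_submatrixProg (by decide) hC hm hc.2).mono le_rfl
    fun σ₁ hF₁ ⟨_, hU⟩ => ?_) (T₂ := 20 * (s + 1) * (20 * (d + 1) * 30))) ?_
  · have hC₁ := hC.frame hF₁ (by decide) (by decide)
    refine (Runs.for (fun k τ => (∀ l : Fin s, (l : ℕ) < k → ∀ j : Fin d, τ.real 1 (c l) j =
      E.vecs (K.submatrix c c) l (Fin.castLE h j)) ∧ ∀ i : Fin n, i ∉ Set.range c →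
      ∀ j : Fin d, τ.real 1 i j = 0) hC₁.var_s (by decide) (by decide) (by omega)
      (fun _ _ _ h => h) ⟨by simp, fun i _ j => ?_⟩ ?_).mono le_rfl fun τ _ ⟨hτ₁, hτ₂⟩ => ⟨?_, ?_⟩
    · rw [hF₁.real 1 (by decide), h1]
    · rintro k hk τ hF h10 ⟨hτ₁, hτ₂⟩
      have hC₂ := hC₁.frame hF (by decide) (by decide)
      refine (Runs.for (T := 30) (fun k' τ => (∀ l : Fin s, (l : ℕ) < k → ∀ j : Fin d,
        τ.real 1 (c l) j = E.vecs (K.submatrix c c) l (Fin.castLE h j)) ∧ (∀ j : Fin d,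
        (j : ℕ) < k' → τ.real 1 (c ⟨k, hk⟩) j = E.vecs (K.submatrix c c) ⟨k, hk⟩ (Fin.castLE h j)) ∧
        ∀ i : Fin n, i ∉ Set.range c → ∀ j : Fin d, τ.real 1 i j = 0) hC₂.var_d (by decide)
        (by decide) (by omega) (fun _ _ _ h => h) ⟨hτ₁, by simp, hτ₂⟩ ?_).mono le_rfl ?_
      · rintro k' hk' τ' hF' h11 ⟨h₁, h₂, h₃⟩
        have h10' : τ'.var 10 = k := by rw [hF'.var 10 (by decide), h10]
        have h8 : τ'.var 8 = m := by
          rw [hF'.var 8 (by decide), hF.var 8 (by decide), hF₁.var 8 (by decide), hm]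
        have h0 : τ'.nat 0 = σ.nat 0 := by
          rw [hF'.nat 0 (by decide), hF.nat 0 (by decide), hF₁.nat 0 (by decide)]
        have hr3 : τ'.real 3 = σ₁.real 3 := by
          rw [hF'.real 3 (by decide), hF.real 3 (by decide)]
        have hck : σ.nat 0 m k = c ⟨k, hk⟩ := hc.2 ⟨k, hk⟩
        have hUk : σ₁.real 3 k k' = E.vecs (K.submatrix c c) ⟨k, hk⟩ (Fin.castLE h ⟨k', hk'⟩) :=
          hU ⟨k, hk⟩ (Fin.castLE h ⟨k', hk'⟩)
        refine Runs.le (.setReal ⟨fun l hl j => ?_, fun j hj => ?_, fun i hi j => ?_⟩) (by decide)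
        · have : (c l : ℕ) ≠ c ⟨k, hk⟩ := fun hcl => hl.ne (congrArg Fin.val (hc.1 (Fin.ext hcl)))
          simpa [put, NExp.eval, h8, h10', h0, hck, this] using h₁ l hl j
        · by_cases hjk : (j : ℕ) = k'
          · obtain rfl : j = ⟨k', hk'⟩ := Fin.ext hjk
            simp [put, NExp.eval, RExp.eval, h8, h10', h11, h0, hck, hr3, hUk]
          · simpa [put, NExp.eval, h8, h10', h11, h0, hck, hjk] using h₂ j (by omega)
        · have : (i : ℕ) ≠ c ⟨k, hk⟩ := fun hcl => hi ⟨⟨k, hk⟩, (Fin.ext hcl).symm⟩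
          simpa [put, NExp.eval, h8, h10', h0, hck, this] using h₃ i hi j
      · rintro τ' - ⟨h₁, h₂, h₃⟩
        refine ⟨fun l hl j => ?_, h₃⟩
        rcases Nat.lt_succ_iff_lt_or_eq.1 hl with hl | hl
        · exact h₁ l hl j
        · obtain rfl : l = ⟨k, hk⟩ := Fin.ext hl
          exact h₂ j j.2
    · rintro i ⟨j, hj⟩
      by_contra hi
      exact hj (hτ₂ i hi j)
    · exact fun l j => hτ₁ l l.2 j
  · have h₁ : 20 * (s + 1) * (20 * (d + 1) * 30) ≤ 12000 * (s + 1) ^ 3 := by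
      have : (s + 1) * (d + 1) ≤ (s + 1) * ((s + 1) * (s + 1)) :=
        Nat.mul_le_mul_left _ (by nlinarith)
      calc 20 * (s + 1) * (20 * (d + 1) * 30) = 12000 * ((s + 1) * (d + 1)) := by ring
        _ ≤ 12000 * ((s + 1) * ((s + 1) * (s + 1))) := Nat.mul_le_mul_left _ this
        _ = 12000 * (s + 1) ^ 3 := by ring
    have h₃ : 1 ≤ (s + 1) ^ 3 := Nat.one_le_pow _ _ (by omega)
    omega

theorem candidate_eq_range {m : ℕ} {c : Fin s → Fin n} (hc : RowIs m c σ) :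
    σ.candidate n s m = Set.range c := by
  ext i
  constructor
  · rintro ⟨l, hl, hi⟩
    exact ⟨⟨l, hl⟩, Fin.ext ((hc.2 ⟨l, hl⟩).symm.trans hi)⟩
  · rintro ⟨l, rfl⟩
    exact ⟨l, l.2, hc.2 l⟩

theorem runs_mainProg (hK : K.PosSemidef) (hd : 0 < d) (h : d ≤ s) (hsn : s < n) :
    Runs E mainProg (inputState d s K) (200000000 * ((n + 1) ^ 3 +
      (pivotCount n K.rank * (3 * n) ^ (K.rank + 1).choose 2 + 1) * stepCost n d K.rank)) (fun τ =>
      IsOptimal K s (τ.solution n d) ∧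
      τ.numCandidates = pivotCount n K.rank * (3 * n) ^ (K.rank + 1).choose 2 ∧
      (∀ k < τ.numCandidates, (τ.candidate n s k).ncard = s) ∧
      ∃ k < τ.numCandidates, IsOptimalSupport K d s (τ.candidate n s k)) := by
  have hb : 0 < 3 * n := by omega
  set N := pivotCount n K.rank * (3 * n) ^ (K.rank + 1).choose 2 with hN
  refine Runs.le (.seq ((runs_initProg hK).mono le_rfl fun σ₁ hF₁ ⟨hC₁, hbest₁⟩ => .seq
    ((Runs.loop N (Inv E K h) ?_ (fun m hm τ hF hI => ⟨?_, runs_candidateProg hK h hsn hm hI⟩)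
    fun τ hF hI => ?_).mono le_rfl fun σ₂ hF₂ hI => ?_))) ?_
    (T := 1 + (n ^ 3 + 1000 * (n + 1)) + (1 + ((N + 1) * (100000000 * stepCost n d K.rank + 6 + 1)) +
      30000 * (s + 1) ^ 3))
  · have hnat : σ₁.nat 1 = fun _ _ => 0 := by
      rw [hF₁.nat 1 (by decide)]
      rfl
    refine ⟨hC₁, ?_, ⟨fun k _ => by simp [hnat], by simp [hnat]⟩, by simp, Or.inl ⟨rfl, hbest₁⟩⟩
    rw [hF₁.var 3 (by decide)]
    rfl
  · have := (Nat.div_lt_iff_lt_mul (Nat.pow_pos hb)).2 hm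
    simp only [Test.holds, NExp.eval, digitExp, hI.ctx.pivots, hI.ctx.dim, hI.digits.2]
    omega
  -- The loop tests the leading digit, which reaches the number of pivots exactly when `m = N`.
  · simp only [Test.holds, NExp.eval, digitExp, hI.ctx.pivots, hI.ctx.dim, hI.digits.2]
    rw [not_not, hN, Nat.mul_div_cancel _ (Nat.pow_pos hb)]
  · obtain ⟨hC, h3, -, hrows, hbest⟩ := hI
    have hNpos : 0 < N := Nat.mul_pos (by unfold pivotCount; split_ifs <;> omega) (Nat.pow_pos hb)
    obtain ⟨hlt, c, hc, hval⟩ := hbest.resolve_left fun h => hNpos.ne' h.1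
    -- Encode the pivot, points and values given by `exists_maximal_candidate` as a number `m < N`:
    -- the support stored in row `m` is maximal, and the best candidate is at least as good.
    have hmax : ∀ c' : Fin s → Fin n, c'.Injective →
        supportValue E K h c' ≤ supportValue E K h c := by
      obtain ⟨e, t, y, he, hy, hall⟩ := exists_maximal_candidate E hK (by omega) hsn.le h rfl
      choose z hz hzt hzy using fun k => exists_digit (t k) (hy k)
      obtain ⟨m, hme, hmz⟩ := exists_digits _ z hz e
      have hmN : m < N := by
        rw [hN, ← Nat.div_lt_iff_lt_mul (Nat.pow_pos hb), hme]
        unfold pivotCount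
        split_ifs with hr
        · rw [he hr]
          exact Nat.one_pos
        · exact e.2
      obtain ⟨c₀, hc₀, hsel, hle⟩ := hrows m hmN
      intro c' hc'
      rw [hval]
      exact (hall c₀ hc₀.1 (hsel e t y hme (fun k => by rw [hmz, hzt])
        fun k => by rw [hmz, hzy]) c' hc').trans hle
    refine (runs_outputProg hC h rfl hc ?_).mono le_rfl fun τ hF ⟨hX, hXc⟩ => ?_
    · intro i j
      rw [hF₂.real 1 (by decide), hF₁.real 1 (by decide)]
      simp [inputState]
    have hopt := isOptimal_of_eigenvectors E hK h hsn.le hc.1 hmax hX hXc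
    have hnum : τ.numCandidates = N := by rw [State.numCandidates, hF.var 3 (by decide), h3]
    have h0 : τ.nat 0 = σ₂.nat 0 := hF.nat 0 (by decide)
    have hrow : ∀ {m : ℕ} {c : Fin s → Fin n}, RowIs m c σ₂ → RowIs m c τ := fun hc =>
      ⟨hc.1, by rw [h0]; exact hc.2⟩
    refine ⟨hopt, hnum, fun k hk => ?_, σ₂.var 8, by rwa [hnum], ?_⟩
    · obtain ⟨c', hc', -⟩ := hrows k (by rwa [← hnum])
      rw [candidate_eq_range (hrow hc'), ncard_range hc'.1]
    · rw [candidate_eq_range (hrow hc)]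
      exact ⟨ncard_range hc.1, _, hopt, hX⟩
  · have h₁ : n ^ 3 ≤ (n + 1) ^ 3 := Nat.pow_le_pow_left (by omega) 3
    have h₂ : (s + 1) ^ 3 ≤ (n + 1) ^ 3 := Nat.pow_le_pow_left (by omega) 3
    have h₃ : n + 1 ≤ (n + 1) ^ 3 := Nat.le_self_pow (by norm_num) _
    have h₄ : N + 1 ≤ (N + 1) * stepCost n d K.rank :=
      Nat.le_mul_of_pos_right _ (Nat.add_pos_left (by positivity) _)
    have h₅ : (N + 1) * (100000000 * stepCost n d K.rank + 6 + 1) =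
      100000000 * ((N + 1) * stepCost n d K.rank) + 7 * (N + 1) := by ring
    rw [h₅]
    omega

end

/-! ### The bounds -/

/-- From `D = 9` on, passing to `D + 1` multiplies the cube by at most `4 / 3`, as `(11 / 10) ^ 3 <
4 / 3`; below, the cube is at most `1000`. -/
theorem three_pow_mul_le (D : ℕ) : 3 ^ D * (D + 1) ^ 3 ≤ 1000 * 4 ^ D := by
  rcases le_total D 9 with h | h
  · have h₁ : 3 ^ D ≤ 4 ^ D := Nat.pow_le_pow_left (by norm_num) D
    have h₂ : (D + 1) ^ 3 ≤ 10 ^ 3 := Nat.pow_le_pow_left (by omega) 3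
    calc 3 ^ D * (D + 1) ^ 3 ≤ 4 ^ D * 10 ^ 3 := Nat.mul_le_mul h₁ h₂
      _ = 1000 * 4 ^ D := by ring
  · induction D, h using Nat.le_induction with
    | base => norm_num
    | succ D hD ih =>
      have h₁ : 3 * (D + 2) ^ 3 ≤ 4 * (D + 1) ^ 3 := by
        obtain ⟨k, rfl⟩ := Nat.exists_eq_add_of_le hD
        nlinarith [Nat.zero_le (k ^ 3), Nat.zero_le (k ^ 2), Nat.zero_le k]
      calc 3 ^ (D + 1) * (D + 1 + 1) ^ 3 = 3 ^ D * (3 * (D + 2) ^ 3) := by ring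
        _ ≤ 3 ^ D * (4 * (D + 1) ^ 3) := Nat.mul_le_mul_left _ h₁
        _ = 4 * (3 ^ D * (D + 1) ^ 3) := by ring
        _ ≤ 4 * (1000 * 4 ^ D) := Nat.mul_le_mul_left _ ih
        _ = 1000 * 4 ^ (D + 1) := by ring

/-- For `n ≥ 4` one has `4 ^ D * n ^ 3 ≤ 64 * n ^ D`. For `n ≤ 3` the bound on `D` gives `D ≤ 6`,
and the left side is at most `3 ^ 6 * 7 ^ 3 * 3 ^ 3 < 7000000`. -/
theorem three_pow_mul_cube_le {n D : ℕ} (hn : 0 < n) (h3 : 3 ≤ D) (hD : D ≤ (n + 1).choose 2) :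
    3 ^ D * (D + 1) ^ 3 * n ^ 3 ≤ 7000000 * n ^ D := by
  rcases le_or_gt 4 n with h | h
  · obtain ⟨k, rfl⟩ := Nat.exists_eq_add_of_le h3
    calc 3 ^ (3 + k) * (3 + k + 1) ^ 3 * n ^ 3 ≤ 1000 * 4 ^ (3 + k) * n ^ 3 :=
          Nat.mul_le_mul_right _ (three_pow_mul_le _)
      _ = 64000 * (4 ^ k * n ^ 3) := by ring
      _ ≤ 7000000 * (n ^ k * n ^ 3) := Nat.mul_le_mul (by norm_num)
          (Nat.mul_le_mul_right _ (Nat.pow_le_pow_left h k))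
      _ = 7000000 * n ^ (3 + k) := by ring
  · have h6 : D ≤ 6 := hD.trans ((Nat.choose_le_choose 2 (by omega : n + 1 ≤ 4)).trans (by decide))
    calc 3 ^ D * (D + 1) ^ 3 * n ^ 3 ≤ 3 ^ 6 * 7 ^ 3 * 3 ^ 3 := Nat.mul_le_mul (Nat.mul_le_mul
          (Nat.pow_le_pow_right (by norm_num) h6) (Nat.pow_le_pow_left (by omega) 3))
          (Nat.pow_le_pow_left (by omega) 3)
      _ ≤ 7000000 * 1 := by norm_num
      _ ≤ 7000000 * n ^ D := Nat.mul_le_mul_left _ (Nat.one_le_pow _ _ hn)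

theorem two_mul_choose (r : ℕ) : 2 * (r + 1).choose 2 = r ^ 2 + r := by
  rw [Nat.choose_two_right, Nat.add_sub_cancel, mul_comm (r + 1) r,
    Nat.mul_div_cancel' (Nat.even_mul_succ_self r).two_dvd]
  ring

/-- The number of candidates times the time for each of them. -/
theorem count_mul_stepCost_le {n d r : ℕ} (hn : 0 < n) (hr : 0 < r) (hrn : r ≤ n) (hd : 0 < d) :
    pivotCount n r * (3 * n) ^ (r + 1).choose 2 * stepCost n d r ≤
      200000000 * (n ^ (r ^ 2 + r) * n) := by
  have hn2 : n + 1 ≤ 2 * n := by omega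
  have hv : valueCost n d r ≤ 8 * n ^ 3 := by
    unfold valueCost
    split_ifs
    · omega
    · calc (n + 1) ^ 3 ≤ (2 * n) ^ 3 := Nat.pow_le_pow_left hn2 3
        _ = 8 * n ^ 3 := by ring
  rw [pivotCount, if_neg hr.ne', stepCost, ← two_mul_choose]
  -- For `r ≥ 2` there are `D ≥ 3` points, and the spare factor `n ^ D` absorbs `3 ^ D` and the
  -- cubic costs. For `r = 1` the value costs nothing extra, as `1 ≤ d`.
  rcases Nat.lt_or_ge 1 r with h | h
  · have h3 : 3 ≤ (r + 1).choose 2 := (by decide : 3 ≤ (2 + 1).choose 2).trans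
      (Nat.choose_le_choose 2 (by omega))
    have hD := three_pow_mul_cube_le hn h3 (Nat.choose_le_choose 2 (by omega : r + 1 ≤ n + 1))
    generalize (r + 1).choose 2 = D at *
    have h₁ : (n + 1) * (D + 1) ^ 3 + valueCost n d r ≤ 10 * ((D + 1) ^ 3 * n ^ 3) := by
      have e₁ : (n + 1) * (D + 1) ^ 3 ≤ 2 * ((D + 1) ^ 3 * n ^ 3) := by
        calc (n + 1) * (D + 1) ^ 3 ≤ (2 * n ^ 3) * (D + 1) ^ 3 := Nat.mul_le_mul_right _
              (hn2.trans (Nat.mul_le_mul_left _ (Nat.le_self_pow (by norm_num) n)))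
          _ = 2 * ((D + 1) ^ 3 * n ^ 3) := by ring
      have e₂ : n ^ 3 ≤ (D + 1) ^ 3 * n ^ 3 := Nat.le_mul_of_pos_left _ (by positivity)
      omega
    calc n * (3 * n) ^ D * ((n + 1) * (D + 1) ^ 3 + valueCost n d r)
        ≤ n * (3 * n) ^ D * (10 * ((D + 1) ^ 3 * n ^ 3)) := Nat.mul_le_mul_left _ h₁
      _ = 10 * (n * n ^ D) * (3 ^ D * (D + 1) ^ 3 * n ^ 3) := by rw [mul_pow]; ring
      _ ≤ 10 * (n * n ^ D) * (7000000 * n ^ D) := Nat.mul_le_mul_left _ hD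
      _ = 70000000 * (n ^ (2 * D) * n) := by ring
      _ ≤ 200000000 * (n ^ (2 * D) * n) := Nat.mul_le_mul_right _ (by norm_num)
  · obtain rfl : r = 1 := by omega
    have : valueCost n d 1 = 0 := if_pos (by omega)
    norm_num [this]
    nlinarith [Nat.mul_le_mul_left (n * (3 * n)) hn2]

/-- For positive rank this follows from the bound on the total time by cancelling `n`, since each
candidate costs at least `n`; there `d` is taken to be `r`. -/
theorem count_le {n r : ℕ} (hn : 0 < n) (hrn : r ≤ n) :
    pivotCount n r * (3 * n) ^ (r + 1).choose 2 ≤ 200000000 * n ^ (r ^ 2 + r) := by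
  rcases Nat.eq_zero_or_pos r with rfl | hr
  · simp [pivotCount]
  · refine Nat.le_of_mul_le_mul_right ?_ hn
    refine (Nat.mul_le_mul_left _ ?_).trans ((count_mul_stepCost_le hn hr hrn hr).trans (by linarith))
    have : 1 ≤ ((r + 1).choose 2 + 1) ^ 3 := Nat.one_le_pow _ _ (by omega)
    unfold stepCost
    nlinarith

theorem time_le {n d r : ℕ} (hn : 0 < n) (hr : 0 < r) (hrn : r ≤ n) (hd : 0 < d) :
    (n + 1) ^ 3 + (pivotCount n r * (3 * n) ^ (r + 1).choose 2 + 1) * stepCost n d r ≤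
      500000000 * (n ^ (r ^ 2 + r) * n) := by
  have h := count_mul_stepCost_le hn hr hrn hd
  have h₁ : 1 ≤ pivotCount n r * (3 * n) ^ (r + 1).choose 2 := by
    rw [pivotCount, if_neg hr.ne']
    exact Nat.mul_pos hn (Nat.pow_pos (by omega))
  have h₂ : (n + 1) ^ 3 ≤ 8 * (n ^ (r ^ 2 + r) * n) := by
    calc (n + 1) ^ 3 ≤ (2 * n) ^ 3 := Nat.pow_le_pow_left (by omega) 3
      _ = 8 * (n ^ 2 * n) := by ring
      _ ≤ 8 * (n ^ (r ^ 2 + r) * n) := Nat.mul_le_mul_left _ (Nat.mul_le_mul_right _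
          (Nat.pow_le_pow_right hn (by nlinarith)))
  have h₃ : (pivotCount n r * (3 * n) ^ (r + 1).choose 2 + 1) * stepCost n d r ≤
      2 * (pivotCount n r * (3 * n) ^ (r + 1).choose 2 * stepCost n d r) := by
    rw [← mul_assoc]
    exact Nat.mul_le_mul_right _ (by omega)
  omega

end SPCA

/-! ### Assembly of the program and the bounds -/

theorem theorem1 :
    ∃ (P : SPCA.Prog) (C : ℝ), ∀ (E : SPCA.EigenSolver) (n d s : ℕ)
      (K : Matrix (Fin n) (Fin n) ℝ), 0 < d → d ≤ s → s < n → K.PosSemidef →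
      ∃ (t : ℕ) (σ : SPCA.State), SPCA.Exec E P (SPCA.inputState d s K) t σ ∧
        SPCA.IsOptimal K s (σ.solution n d) ∧
        (K ≠ 0 → (t : ℝ) ≤ C * ((n : ℝ) ^ (min d K.rank * (K.rank ^ 2 + K.rank)) *
          ((min d K.rank : ℕ) * n * (K.rank : ℝ) ^ 2 + n * Real.log n))) ∧
        (σ.numCandidates : ℝ) ≤ C * (n : ℝ) ^ (min d K.rank * (K.rank ^ 2 + K.rank)) ∧
        (∀ k < σ.numCandidates, (σ.candidate n s k).ncard = s) ∧
        ∃ k < σ.numCandidates, SPCA.IsOptimalSupport K d s (σ.candidate n s k) := by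
  -- The constant is the product of those in `runs_mainProg` and `time_le`.
  refine ⟨SPCA.mainProg, 200000000 * 500000000, fun E n d s K hd h hsn hK => ?_⟩
  obtain ⟨t, σ, hexec, ht, hopt, hnum, hcard, hsupp⟩ := SPCA.runs_mainProg (E := E) hK hd h hsn
  have hn : 0 < n := by omega
  have hn1 : (1 : ℝ) ≤ n := by exact_mod_cast hn
  have hrn : K.rank ≤ n := by simpa using K.rank_le_width
  -- The exponent `r ^ 2 + r` already suffices; the factor `min d r` is at least one unless `r = 0`,
  -- when both exponents vanish.
  have hpow : n ^ (K.rank ^ 2 + K.rank) ≤ n ^ (min d K.rank * (K.rank ^ 2 + K.rank)) := by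
    refine Nat.pow_le_pow_right hn ?_
    rcases Nat.eq_zero_or_pos K.rank with h0 | h0
    · simp [h0]
    · exact Nat.le_mul_of_pos_left _ (lt_min hd h0)
  refine ⟨t, σ, hexec, hopt, fun hK0 => ?_, ?_, hcard, hsupp⟩
  · have hr : 0 < K.rank := by
      refine Nat.pos_of_ne_zero fun h0 => hK0 ?_
      obtain ⟨B, hB⟩ := SPCA.exists_eq_transpose_mul_self hK
      have : IsEmpty (Fin K.rank) := by
        rw [h0]
        infer_instance
      ext i j
      rw [hB]
      simp [Matrix.mul_apply]
    have h₁ : t ≤ 200000000 * (500000000 * (n ^ (min d K.rank * (K.rank ^ 2 + K.rank)) * n)) :=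
      ht.trans (Nat.mul_le_mul_left _ ((SPCA.time_le hn hr hrn hd).trans
        (Nat.mul_le_mul_left _ (Nat.mul_le_mul_right _ hpow))))
    -- The polynomial term alone dominates the remaining factor `n`; the logarithmic term is only
    -- used to be nonnegative.
    have h₂ : n ≤ min d K.rank * n * K.rank ^ 2 := by
      rw [mul_right_comm]
      exact Nat.le_mul_of_pos_left _ (Nat.mul_pos (lt_min hd hr) (by positivity))
    have h₃ : (n : ℝ) ≤ (min d K.rank : ℕ) * n * (K.rank : ℝ) ^ 2 + n * Real.log n := by
      have : (n : ℝ) ≤ (min d K.rank : ℕ) * n * (K.rank : ℝ) ^ 2 := by exact_mod_cast h₂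
      have := mul_nonneg (Nat.cast_nonneg n) (Real.log_nonneg hn1)
      linarith
    calc (t : ℝ) ≤ 200000000 * (500000000 * ((n : ℝ) ^ (min d K.rank * (K.rank ^ 2 + K.rank)) *
          n)) := by exact_mod_cast h₁
      _ = 200000000 * 500000000 * ((n : ℝ) ^ (min d K.rank * (K.rank ^ 2 + K.rank)) * n) := by
          ring
      _ ≤ _ := by gcongr
  · have h₁ : σ.numCandidates ≤ 200000000 * 500000000 *
        n ^ (min d K.rank * (K.rank ^ 2 + K.rank)) := by
      rw [hnum]
      exact (SPCA.count_le hn hrn).trans (Nat.mul_le_mul (by norm_num) hpow)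
    exact_mod_cast h₁
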